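/- **Setting.** Let $\dim\in\{2,3\}$ and let $\Omega\subset\mathbb R^{\dim}$ be a bounded connected polygonal (polyhedral) domain, divided into two non-overlapping polygonal subdomains $\Omega^s,\Omega^d$, so that $\overline\Omega=\overline{\Omega^s}\cup\overline{\Omega^d}$, with interface $\Gamma^I$. Let $\mathcal T^s,\mathcal T^d$ be conforming simplicial triangulations of $\Omega^s,\Omega^d$ that match at $\Gamma^I$, and $\mathcal T=\mathcal T^s\cup\mathcal T^d$; $h_K$ is the diameter of $K\in\mathcal T$ and $n$ the outward unit normal on $\partial K$. For $j=s,d$ let $\mathcal F^j$ be the set of facets of elements of $\mathcal T^j$, $\mathcal F=\mathcal F^s\cup\mathcal F^d$, and let $\Gamma_0^j,\Gamma_0$ be the unions of the facets in $\mathcal F^j,\mathcal F$. $(\cdot,\cdot)_K$ and $\langle\cdot,\cdot\rangle_{\partial K}$ denote $L^2$-inner products, and $P_m$ polynomials of degree at most $m$. On $\Gamma^I$, $n$ is the unit normal pointing out of $\Omega^s$ and $w^t=w-(w\cdot n)n$. **Flow discretization.** Let $k\ge1$, $\mu,\kappa,\alpha,\beta_f>0$, $f^s\in L^2(\Omega^s)^{\dim}$,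 $f^d\in L^2(\Omega^d)$. Let $V_h$ be the space of vector fields that are in $P_k(K)^{\dim}$ on each $K\in\mathcal T$; $\bar V_h$ the continuous vector fields on $\Gamma_0^s$ that are in $P_k(F)^{\dim}$ on each $F\in\mathcal F^s$ and vanish on the facets contained in $\partial\Omega$; $Q_h$ the functions of mean zero on $\Omega$ that are in $P_{k-1}(K)$ on each $K\in\mathcal T$; and $\bar Q_h^j$ the functions on $\Gamma_0^j$ that are in $P_k(F)$ on each $F\in\mathcal F^j$ (not necessarily continuous), $j=s,d$. With $\varepsilon(u)=\frac12(\nabla u+\nabla u^T)$ put $$\begin{aligned} a_h(\boldsymbol u,\boldsymbol v)={}&\sum_{K\in\mathcal T^s}\Big[(2\mu\varepsilon(u),\varepsilon(v))_K+\big\langle\tfrac{2\beta_f\mu}{h_K}(u-\bar u),v-\bar v\big\rangle_{\partial K}-\langle2\mu\varepsilon(u)n,v-\bar v\rangle_{\partial K}-\langle2\mu\varepsilon(v)n,u-\bar u\rangle_{\partial K}\Big]\\ &+(\kappa^{-1}u,v)_{\Omega^d}+\langle\alpha\kappa^{-1/2}\bar u^t,\bar v^t\rangle_{\Gamma^I},\\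 b_h(\boldsymbol p,\boldsymbol v)={}&-\sum_{K\in\mathcal T}(p,\nabla\cdot v)_K+\sum_{j=s,d}\sum_{K\in\mathcal T^j}\langle\bar p^j,v\cdot n\rangle_{\partial K}-\langle\bar p^s-\bar p^d,\bar v\cdot n\rangle_{\Gamma^I}. \end{aligned}$$ Let $\boldsymbol u_h=(u_h,\bar u_h)\in V_h\times\bar V_h$, $\boldsymbol p_h=(p_h,\bar p_h^s,\bar p_h^d)\in Q_h\times\bar Q_h^s\times\bar Q_h^d$ be a solution of the EDG-HDG scheme $$a_h(\boldsymbol u_h,\boldsymbol v_h)+b_h(\boldsymbol p_h,\boldsymbol v_h)+b_h(\boldsymbol q_h,\boldsymbol u_h)=(f^s,v_h)_{\Omega^s}+(f^d,q_h)_{\Omega^d}$$ for all $\boldsymbol v_h\in V_h\times\bar V_h$, $\boldsymbol q_h\in Q_h\times\bar Q_h^s\times\bar Q_h^d$. **Transport discretization.** Let $T>0$, $\ell\ge0$, $\beta_c>0$; let the porosity $\phi$ be $1$ in $\Omega^s$ and a constant in $(0,1]$ in $\Omega^d$; let $c_0\in L^2(\Omega)$ and $f\in L^2(0,T;L^2(\Omega))$.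 Let $D:\mathbb R^{\dim}\to\mathbb R^{\dim\times\dim}$ satisfy, with constants $D_{\min},C>0$ and for all $u,v,x\in\mathbb R^{\dim}$, $$D_{\min}|x|^2\le D(u)x\cdot x,\qquad |D(u)|\le C(1+|u|),\qquad |D(u)-D(v)|\le C|u-v|.$$ Let $C_h$ be the space of functions that are in $P_\ell(K)$ on each $K\in\mathcal T$, and $\bar C_h$ the space of continuous functions on $\Gamma_0$ that are in $P_\ell(F)$ on each $F\in\mathcal F$. Put $B_h=B_h^a+B_h^d$ with $$\begin{aligned} B_h^a(u;\boldsymbol c,\boldsymbol w)=\sum_{K\in\mathcal T}\Big[&-(c\,u,\nabla w)_K+\langle c\,u\cdot n,w-\bar w\rangle_{\partial K}-\langle u\cdot n\,(c-\bar c),w-\bar w\rangle_{\partial K^{\rm in}}\Big],\\ B_h^d(u;\boldsymbol c,\boldsymbol w)=\sum_{K\in\mathcal T}\Big[&(D(u)\nabla c,\nabla w)_K-\langle[D(u)\nabla c]\cdot n,w-\bar w\rangle_{\partial K}\\ &+\tfrac{\beta_c}{h_K}\langle[D(u)n](c-\bar c),(w-\bar w)n\rangle_{\partial K}-\langle[D(u)\nabla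 w]\cdot n,c-\bar c\rangle_{\partial K}\Big], \end{aligned}$$ where $\partial K^{\rm in}$ is the part of $\partial K$ on which $u\cdot n<0$. The semi-discrete EDG scheme is: find $\boldsymbol c_h(t)=(c_h(t),\bar c_h(t))\in C_h\times\bar C_h$ such that $c_h(0)$ is the $L^2$-projection of $c_0$ into $C_h$ and $$\sum_{K\in\mathcal T}(\phi\,\partial_tc_h(t),w_h)_K+B_h(u_h;\boldsymbol c_h(t),\boldsymbol w_h)=\sum_{K\in\mathcal T}(f(t),w_h)_K\qquad\forall\,\boldsymbol w_h=(w_h,\bar w_h)\in C_h\times\bar C_h.\tag{$*$}$$ **Theorem (existence and uniqueness).** The semi-discrete scheme has a unique solution $\boldsymbol c_h$. Precisely: 1. There is a solution $\boldsymbol c_h=(c_h,\bar c_h)$ with $c_h:[0,T]\to C_h$ absolutely continuous and $(*)$ holding for almost every $t\in(0,T]$. Any two such solutions have the same $c_h(t)$ for all $t\in[0,T]$ and the same $\bar c_h(t)$ for almost every $t\in(0,T]$. 2. If moreover $f:(0,T]\to L^2(\Omega)$ is continuous, there is a solution with $c_h$ continuous on $[0,T]$, differentiable on $(0,T]$ (one-sidedly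 at $T$), and $(*)$ holding for every $t\in(0,T]$. Any two such solutions have the same $c_h(t)$ for all $t\in[0,T]$ and the same $\bar c_h(t)$ for all $t\in(0,T]$. -/

import Mathlib

open MeasureTheory Set

noncomputable section

namespace StokesDarcyTransport

/-- The Euclidean space `ℝ^d`. -/
abbrev Euc (d : ℕ) := EuclideanSpace ℝ (Fin d)

/-- The two regions: free flow (Stokes) and porous medium (Darcy). -/
inductive Region
  | stokes
  | darcy
  deriving DecidableEq

instance : Fintype Region where
  elems := {Region.stokes, Region.darcy}
  complete := by rintro (_ | _) <;> simp

/-! ### Geometry: simplices, polygonal domains, triangulations -/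

/-- `S` is the vertex set of a nondegenerate `d`-simplex in `ℝ^d`. -/
def IsSimplex {d : ℕ} (S : Finset (Euc d)) : Prop :=
  S.card = d + 1 ∧ AffineIndependent ℝ ((↑) : S → Euc d)

/-- The closed simplex (or facet) spanned by a finite set of vertices. -/
def hull {d : ℕ} (S : Finset (Euc d)) : Set (Euc d) := convexHull ℝ (S : Set (Euc d))

/-- A nonempty bounded open set that is polygonal (polyhedral if `d = 3`): its closure is a finite
union of closed simplices, and it is the interior of its closure (it has no slits). -/
def IsPolygonal {d : ℕ} (U : Set (Euc d)) : Prop :=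
  IsOpen U ∧ U.Nonempty ∧ interior (closure U) = U ∧
    ∃ 𝒮 : Finset (Finset (Euc d)), (∀ S ∈ 𝒮, IsSimplex S) ∧ closure U = ⋃ S ∈ 𝒮, hull S

/-- A polygonal domain `Ω` divided into non-overlapping polygonal subdomains `Ω^s`, `Ω^d`. -/
structure SplitDomain (d : ℕ) where
  /-- the whole domain `Ω` -/
  whole : Set (Euc d)
  /-- the subdomains `Ω^s`, `Ω^d` -/
  part : Region → Set (Euc d)
  polygonal_whole : IsPolygonal whole
  connected_whole : IsConnected whole
  polygonal_part : ∀ j, IsPolygonal (part j)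
  disjoint_part : Disjoint (part .stokes) (part .darcy)
  closure_whole : closure whole = closure (part .stokes) ∪ closure (part .darcy)

/-- Conforming simplicial triangulations `𝒯^s`, `𝒯^d` of the two subdomains, matching at the
interface; an element is given by its set of vertices. -/
structure Mesh {d : ℕ} (Ω : SplitDomain d) where
  /-- the elements of `𝒯^s` and of `𝒯^d` -/
  cells : Region → Finset (Finset (Euc d))
  isSimplex : ∀ j, ∀ S ∈ cells j, IsSimplex S
  conforming : ∀ i j, ∀ S ∈ cells i, ∀ S' ∈ cells j,
    hull S ∩ hull S' = convexHull ℝ ((S : Set (Euc d)) ∩ (S' : Set (Euc d)))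
  cover : ∀ j, ⋃ S ∈ cells j, hull S = closure (Ω.part j)

/-- The facet of the simplex `S` opposite to its vertex `v`, as a set of vertices. -/
def facet {d : ℕ} (S : Finset (Euc d)) (v : Euc d) : Finset (Euc d) :=
  open scoped Classical in S.erase v

/-- The unit normal to the facet of `S` opposite to `v`, pointing out of `S`: the normalized
component, orthogonal to the facet, of the vector from `v` to the barycentre of the facet. -/
def outwardNormal {d : ℕ} (S : Finset (Euc d)) (v : Euc d) : Euc d :=
  let w := (vectorSpan ℝ (facet S v : Set (Euc d)))ᗮ.starProjection
    ((facet S v).centroid ℝ id - v)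
  ‖w‖⁻¹ • w

/-- Surface integral over the facet `F` of a mesh of `ℝ^d` (`(d-1)`-dimensional area). -/
def facetInt {d : ℕ} (F : Finset (Euc d)) (g : Euc d → ℝ) : ℝ :=
  ∫ x in hull F, g x ∂(μHE[d - 1])

/-- Integral over `∂K`, where `K = hull S`, of a function `g F n x` of the facet `F`, the outward
unit normal `n` of `K` on `F`, and the point `x ∈ F`. -/
def bdryInt {d : ℕ} (S : Finset (Euc d)) (g : Finset (Euc d) → Euc d → Euc d → ℝ) : ℝ :=
  ∑ v ∈ S, facetInt (facet S v) (g (facet S v) (outwardNormal S v))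

/-- The diameter `h_K` of an element. -/
def diamCell {d : ℕ} (S : Finset (Euc d)) : ℝ := Metric.diam (hull S)

/-! ### Polynomials and differential operators -/

/-- `P_k`: polynomial functions on `ℝ^d` of total degree at most `k`. -/
def polyFun (d k : ℕ) : Submodule ℝ (Euc d → ℝ) :=
  (MvPolynomial.restrictTotalDegree (Fin d) ℝ k).map
    (LinearMap.pi fun x : Euc d =>
      (MvPolynomial.aeval (R := ℝ) (fun i : Fin d => x i)).toLinearMap)

/-- The divergence `∇ ⋅ v`. -/
def divergence {d : ℕ} (v : Euc d → Euc d) (x : Euc d) : ℝ :=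
  ∑ i : Fin d, fderiv ℝ v x (EuclideanSpace.single i 1) i

/-- The strain rate tensor `ε(v) = (∇v + ∇vᵀ) / 2`. -/
def strain {d : ℕ} (v : Euc d → Euc d) (x : Euc d) : Euc d →L[ℝ] Euc d :=
  (1 / 2 : ℝ) • (fderiv ℝ v x + ContinuousLinearMap.adjoint (fderiv ℝ v x))

/-- The product `A : B = ∑ i j, A i j * B i j` of two tensors. -/
def frob {d : ℕ} (A B : Euc d →L[ℝ] Euc d) : ℝ :=
  ∑ i : Fin d, inner ℝ (A (EuclideanSpace.single i 1)) (B (EuclideanSpace.single i 1))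

/-- The component `w^t = w - (w ⋅ n) n` of `w` tangential to the hyperplane with unit normal `n`. -/
def tangential {d : ℕ} (n w : Euc d) : Euc d := w - inner ℝ w n • n

namespace Mesh

variable {d : ℕ} {Ω : SplitDomain d} (𝒯 : Mesh Ω)

/-- The elements of the triangulation `𝒯^j`. -/
abbrev PartCell (j : Region) := {S : Finset (Euc d) // S ∈ 𝒯.cells j}

/-- The elements of `𝒯 = 𝒯^s ∪ 𝒯^d`. -/
abbrev Cell := Σ j : Region, 𝒯.PartCell j

/-- The facets `𝓕^j` of the elements of `𝒯^j`. -/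
def facets (j : Region) : Set (Finset (Euc d)) :=
  {F | ∃ S ∈ 𝒯.cells j, ∃ v ∈ S, F = facet S v}

/-- The union `Γ_0^j` of the facets in `𝓕^j`. -/
def skeletonPart (j : Region) : Set (Euc d) := ⋃ F ∈ 𝒯.facets j, hull F

/-- The union `Γ_0` of all facets. -/
def skeleton : Set (Euc d) := ⋃ j, 𝒯.skeletonPart j

/-- The integral over the interface `Γ^I`, the union of the facets common to `𝒯^s` and `𝒯^d`, of a
function `g F n x`, where `n` is the unit normal on `Γ^I` pointing out of `Ω^s`. -/
def interfaceInt (g : Finset (Euc d) → Euc d → Euc d → ℝ) : ℝ :=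
  open scoped Classical in
  ∑ S : 𝒯.PartCell .stokes, ∑ v ∈ S.1 with facet S.1 v ∈ 𝒯.facets .darcy,
    facetInt (facet S.1 v) (g (facet S.1 v) (outwardNormal S.1 v))

end Mesh

/-! ### The EDG-HDG method for the Stokes--Darcy system -/

/-- Arguments `((u, ū), (p, p̄^s, p̄^d))` of the flow discretization. The broken fields `u`, `p`
assign to each element a function; only its values on that element are used. Only the values of
`ū` on `Γ_0^s` and of `p̄^j F` on the facet `F ∈ 𝓕^j` are used. -/
structure FlowField {d : ℕ} {Ω : SplitDomain d} (𝒯 : Mesh Ω) where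
  /-- the element velocity -/
  u : 𝒯.Cell → Euc d → Euc d
  /-- the facet velocity -/
  ubar : Euc d → Euc d
  /-- the element pressure -/
  p : 𝒯.Cell → Euc d → ℝ
  /-- the facet pressures -/
  pbar : Region → Finset (Euc d) → Euc d → ℝ

/-- Membership in the discrete space `X_h = (V_h × V̄_h) × (Q_h × Q̄_h^s × Q̄_h^d)` of degree `k`. -/
structure FlowField.MemXh {d : ℕ} {Ω : SplitDomain d} {𝒯 : Mesh Ω} (k : ℕ)
    (U : FlowField 𝒯) : Prop where
  u_poly : ∀ K i, (fun x => U.u K x i) ∈ polyFun d k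
  ubar_continuous : ContinuousOn U.ubar (𝒯.skeletonPart .stokes)
  ubar_poly : ∀ F ∈ 𝒯.facets .stokes, ∃ q : Euc d → Euc d,
    (∀ i, (fun x => q x i) ∈ polyFun d k) ∧ EqOn U.ubar q (hull F)
  ubar_zero : ∀ F ∈ 𝒯.facets .stokes, hull F ⊆ frontier Ω.whole → ∀ x ∈ hull F, U.ubar x = 0
  p_poly : ∀ K, U.p K ∈ polyFun d (k - 1)
  p_mean : ∑ K : 𝒯.Cell, ∫ x in hull K.2.1, U.p K x = 0
  pbar_poly : ∀ j, ∀ F ∈ 𝒯.facets j, U.pbar j F ∈ polyFun d k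

section FlowForms

variable {d : ℕ} {Ω : SplitDomain d} {𝒯 : Mesh Ω}

/-- The bilinear form `a_h` with viscosity `μ`, permeability `κ`, slip coefficient `α` and penalty
parameter `βf`. -/
def aForm (μ κ α βf : ℝ) (U V : FlowField 𝒯) : ℝ :=
  (∑ S : 𝒯.PartCell .stokes,
      ∫ x in hull S.1, 2 * μ * frob (strain (U.u ⟨_, S⟩) x) (strain (V.u ⟨_, S⟩) x))
  + (∑ S : 𝒯.PartCell .stokes, bdryInt S.1 fun _ _ x =>
      2 * βf * μ / diamCell S.1 *
        inner ℝ (U.u ⟨_, S⟩ x - U.ubar x) (V.u ⟨_, S⟩ x - V.ubar x))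
  - (∑ S : 𝒯.PartCell .stokes, bdryInt S.1 fun _ n x =>
      2 * μ * inner ℝ (strain (U.u ⟨_, S⟩) x n) (V.u ⟨_, S⟩ x - V.ubar x))
  - (∑ S : 𝒯.PartCell .stokes, bdryInt S.1 fun _ n x =>
      2 * μ * inner ℝ (strain (V.u ⟨_, S⟩) x n) (U.u ⟨_, S⟩ x - U.ubar x))
  + (∑ S : 𝒯.PartCell .darcy,
      ∫ x in hull S.1, κ⁻¹ * inner ℝ (U.u ⟨_, S⟩ x) (V.u ⟨_, S⟩ x))
  + 𝒯.interfaceInt fun _ n x =>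
      α * (√κ)⁻¹ * inner ℝ (tangential n (U.ubar x)) (tangential n (V.ubar x))

/-- The bilinear form `b_h(p, v)`, with the pressures of `P` and the velocities of `V`. -/
def bForm (P V : FlowField 𝒯) : ℝ :=
  - (∑ K : 𝒯.Cell, ∫ x in hull K.2.1, P.p K x * divergence (V.u K) x)
  + (∑ K : 𝒯.Cell, bdryInt K.2.1 fun F n x => P.pbar K.1 F x * inner ℝ (V.u K x) n)
  - 𝒯.interfaceInt fun F n x => (P.pbar .stokes F x - P.pbar .darcy F x) * inner ℝ (V.ubar x) n

/-- `U = ((u_h, ū_h), (p_h, p̄_h^s, p̄_h^d))` solves the EDG-HDG scheme of degree `k` for the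
Stokes--Darcy system with data `f^s`, `f^d`. -/
def IsFlowSolution (k : ℕ) (μ κ α βf : ℝ)
    (fs : Lp (Euc d) 2 (volume.restrict (Ω.part .stokes)))
    (fd : Lp ℝ 2 (volume.restrict (Ω.part .darcy))) (U : FlowField 𝒯) : Prop :=
  U.MemXh k ∧ ∀ V : FlowField 𝒯, V.MemXh k →
    aForm μ κ α βf U V + bForm U V + bForm V U
      = (∑ S : 𝒯.PartCell .stokes, ∫ x in hull S.1, inner ℝ (fs x) (V.u ⟨_, S⟩ x))
        + ∑ S : 𝒯.PartCell .darcy, ∫ x in hull S.1, fd x * V.p ⟨_, S⟩ x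

end FlowForms

/-! ### The EDG method for the transport equation -/

section Transport

variable {d : ℕ} {Ω : SplitDomain d} (𝒯 : Mesh Ω)

/-- `C_h`: discontinuous piecewise polynomials of degree at most `ℓ`, given by one polynomial for
each element. -/
def Ch (ℓ : ℕ) : Submodule ℝ (𝒯.Cell → Euc d → ℝ) :=
  Submodule.pi univ fun _ => polyFun d ℓ

/-- `C̄_h`: continuous functions on `Γ_0` that are polynomials of degree at most `ℓ` on each facet;
such a function is represented by its extension by zero to `ℝ^d`. -/
def Cbar (ℓ : ℕ) : Submodule ℝ (Euc d → ℝ) where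
  carrier := {g | ContinuousOn g 𝒯.skeleton ∧
    (∀ j, ∀ F ∈ 𝒯.facets j, ∃ q ∈ polyFun d ℓ, EqOn g q (hull F)) ∧
    ∀ x, x ∉ 𝒯.skeleton → g x = 0}
  zero_mem' := ⟨continuousOn_const, fun _ _ _ => ⟨0, Submodule.zero_mem _, fun _ _ => rfl⟩,
    fun _ _ => rfl⟩
  add_mem' := by
    rintro a b ⟨ha, ha', ha''⟩ ⟨hb, hb', hb''⟩
    refine ⟨ha.add hb, fun j F hF => ?_, fun x hx => by simp [ha'' x hx, hb'' x hx]⟩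
    obtain ⟨p, hp, hpe⟩ := ha' j F hF
    obtain ⟨q, hq, hqe⟩ := hb' j F hF
    exact ⟨p + q, Submodule.add_mem _ hp hq, fun x hx => by simp [hpe hx, hqe hx]⟩
  smul_mem' := by
    rintro r a ⟨ha, ha', ha''⟩
    refine ⟨ha.const_smul r, fun j F hF => ?_, fun x hx => by simp [ha'' x hx]⟩
    obtain ⟨p, hp, hpe⟩ := ha' j F hF
    exact ⟨r • p, Submodule.smul_mem _ r hp, fun x hx => by simp [hpe hx]⟩

variable {𝒯}

/-- The advective form `B_h^a(u; (c, c̄), (w, w̄))`. -/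
def advForm (u : 𝒯.Cell → Euc d → Euc d) (c : 𝒯.Cell → Euc d → ℝ) (cb : Euc d → ℝ)
    (w : 𝒯.Cell → Euc d → ℝ) (wb : Euc d → ℝ) : ℝ :=
  - (∑ K : 𝒯.Cell, ∫ x in hull K.2.1, c K x * inner ℝ (u K x) (gradient (w K) x))
  + (∑ K : 𝒯.Cell, bdryInt K.2.1 fun _ n x => c K x * inner ℝ (u K x) n * (w K x - wb x))
  - ∑ K : 𝒯.Cell, bdryInt K.2.1 fun _ n =>
      {x | inner ℝ (u K x) n < 0}.indicator fun x =>
        inner ℝ (u K x) n * (c K x - cb x) * (w K x - wb x)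

/-- The diffusive form `B_h^d(u; (c, c̄), (w, w̄))` with diffusion/dispersion tensor `D` and penalty
parameter `βc`. -/
def diffForm (D : Euc d → Euc d →L[ℝ] Euc d) (βc : ℝ) (u : 𝒯.Cell → Euc d → Euc d)
    (c : 𝒯.Cell → Euc d → ℝ) (cb : Euc d → ℝ) (w : 𝒯.Cell → Euc d → ℝ) (wb : Euc d → ℝ) : ℝ :=
  (∑ K : 𝒯.Cell, ∫ x in hull K.2.1, inner ℝ (D (u K x) (gradient (c K) x)) (gradient (w K) x))
  - (∑ K : 𝒯.Cell, bdryInt K.2.1 fun _ n x =>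
      inner ℝ (D (u K x) (gradient (c K) x)) n * (w K x - wb x))
  + (∑ K : 𝒯.Cell, βc / diamCell K.2.1 * bdryInt K.2.1 fun _ n x =>
      inner ℝ ((c K x - cb x) • D (u K x) n) ((w K x - wb x) • n))
  - ∑ K : 𝒯.Cell, bdryInt K.2.1 fun _ n x =>
      inner ℝ (D (u K x) (gradient (w K) x)) n * (c K x - cb x)

/-- The porosity: `φ` in `Ω^d` and `1` in `Ω^s`. -/
def porosity (φ : ℝ) : Region → ℝ
  | .stokes => 1
  | .darcy => φ

/-- The semi-discrete EDG equation at time `t ∈ (0, T]`: the time derivative of `c_h` exists at `t`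
(one-sided if `t = T`) and the variational equation holds for all `(w_h, w̄_h) ∈ C_h × C̄_h`. -/
def SolvesAt (ℓ : ℕ) (φ : ℝ) (D : Euc d → Euc d →L[ℝ] Euc d) (βc : ℝ)
    (u : 𝒯.Cell → Euc d → Euc d) (T : ℝ) (f : ℝ → Lp ℝ 2 (volume.restrict Ω.whole))
    (c : ℝ → Ch 𝒯 ℓ × Cbar 𝒯 ℓ) (t : ℝ) : Prop :=
  ∃ dc : Ch 𝒯 ℓ,
    (∀ K x, HasDerivWithinAt (fun s => (c s).1.1 K x) (dc.1 K x) (Icc 0 T) t) ∧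
    ∀ w : Ch 𝒯 ℓ × Cbar 𝒯 ℓ,
      (∑ K : 𝒯.Cell, ∫ x in hull K.2.1, porosity φ K.1 * dc.1 K x * w.1.1 K x)
        + (advForm u (c t).1.1 (c t).2.1 w.1.1 w.2.1
            + diffForm D βc u (c t).1.1 (c t).2.1 w.1.1 w.2.1)
        = ∑ K : 𝒯.Cell, ∫ x in hull K.2.1, f t x * w.1.1 K x

/-- The initial condition: `c` is the `L²`-projection of `c₀` into `C_h`. -/
def IsL2Projection (ℓ : ℕ) (c₀ : Lp ℝ 2 (volume.restrict Ω.whole)) (c : Ch 𝒯 ℓ) : Prop :=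
  ∀ w : Ch 𝒯 ℓ, ∑ K : 𝒯.Cell, ∫ x in hull K.2.1, c.1 K x * w.1 K x
    = ∑ K : 𝒯.Cell, ∫ x in hull K.2.1, c₀ x * w.1 K x

/-- Solutions for `f ∈ L²(0, T; L²(Ω))`: `c_h` is absolutely continuous in time and the equation
holds for almost every `t ∈ (0, T]`. -/
structure IsSolution (ℓ : ℕ) (φ : ℝ) (D : Euc d → Euc d →L[ℝ] Euc d) (βc : ℝ)
    (u : 𝒯.Cell → Euc d → Euc d) (T : ℝ) (f : ℝ → Lp ℝ 2 (volume.restrict Ω.whole))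
    (c₀ : Lp ℝ 2 (volume.restrict Ω.whole)) (c : ℝ → Ch 𝒯 ℓ × Cbar 𝒯 ℓ) : Prop where
  initial : IsL2Projection ℓ c₀ (c 0).1
  absCont : ∀ K x, AbsolutelyContinuousOnInterval (fun s => (c s).1.1 K x) 0 T
  equation : ∀ᵐ t ∂(volume.restrict (Ioc 0 T)), SolvesAt ℓ φ D βc u T f c t

/-- Classical solutions: `c_h` is continuous on `[0, T]` and the equation holds for every
`t ∈ (0, T]`. -/
structure IsClassicalSolution (ℓ : ℕ) (φ : ℝ) (D : Euc d → Euc d →L[ℝ] Euc d) (βc : ℝ)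
    (u : 𝒯.Cell → Euc d → Euc d) (T : ℝ) (f : ℝ → Lp ℝ 2 (volume.restrict Ω.whole))
    (c₀ : Lp ℝ 2 (volume.restrict Ω.whole)) (c : ℝ → Ch 𝒯 ℓ × Cbar 𝒯 ℓ) : Prop where
  initial : IsL2Projection ℓ c₀ (c 0).1
  continuous : ∀ K x, ContinuousOn (fun s => (c s).1.1 K x) (Icc 0 T)
  equation : ∀ t ∈ Ioc 0 T, SolvesAt ℓ φ D βc u T f c t

end Transport

end StokesDarcyTransport

end

/-! With the velocity fixed, the scheme is a linear differential-algebraic system with constant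
coefficients on the finite-dimensional space `Ch` × `Cbar`, in which only `c_h` carries a time
derivative.

Testing with pure facet functions gives an algebraic equation for `c̄_h`. On such functions all
gradient and element terms of `B_h` vanish; what remains is the penalty, bounded below through the
coercivity of `D` by a positive multiple of the squared facet values, plus an upwind term of
favourable sign. The facet block is therefore definite for every positive penalty parameter
(`facet_form_definite`), and `c̄_h = R c_h` can be eliminated. The mass form is definite because the
porosity is positive and simplices have interior (`mass_definite`). Inverting it leaves an ordinary
differential equation `y' = A y + g` in coordinates (`exists_reduction`, `exists_solvesAt_iff`).

The equation is solved with the integrating factor `exp(-tA)`. Duhamel's formula gives an absolutely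
continuous solution for integrable `g`; its derivative exists almost everywhere by Lebesgue
differentiation, and everywhere on `(0, T]` if `g` is continuous there
(`exists_linear_ode_solution`). For uniqueness, `exp(-tA)` times the difference of two solutions has
zero derivative, hence is constant.

The remaining work is to show that the forms really are bilinear, which requires integrability on
cells and facets, and that facet integrals of nonnegative continuous functions detect zero. For the
latter a facet is parametrised isometrically by a convex body in `ℝ^(d-1)`. -/

noncomputable section

namespace StokesDarcyTransport

section

/-! ### Linear algebra -/

/-- On a finite-dimensional space of functions, every linear functional is a linear combination of
point evaluations. -/
theorem span_range_eval_eq_top {X V : Type*} [AddCommGroup V] [Module ℝ V] [FiniteDimensional ℝ V]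
    (ev : X → V →ₗ[ℝ] ℝ) (h : ∀ v, (∀ x, ev x v = 0) → v = 0) :
    Submodule.span ℝ (range ev) = ⊤ := by
  refine Submodule.span_eq_top_of_ne_zero fun z hz => ?_
  by_contra! H
  exact hz (h z fun x => H _ ⟨x, rfl⟩)

/-- Definiteness makes `m` injective as a map into the dual, and equality of dimensions makes it
bijective; `G` is the inverse. No symmetry is needed. -/
theorem exists_unique_of_definite {V : Type*} [AddCommGroup V] [Module ℝ V]
    [FiniteDimensional ℝ V] (m : V →ₗ[ℝ] V →ₗ[ℝ] ℝ) (hm : ∀ v, m v v = 0 → v = 0) :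
    ∃ G : (V →ₗ[ℝ] ℝ) →ₗ[ℝ] V, ∀ v F, (∀ w, m v w = F w) ↔ v = G F := by
  have hinj : Function.Injective m := by
    rw [injective_iff_map_eq_zero]
    exact fun v hv => hm v (by rw [hv]; rfl)
  let e := LinearEquiv.ofInjectiveOfFinrankEq m hinj (Subspace.dual_finrank_eq (K := ℝ)).symm
  refine ⟨e.symm.toLinearMap, fun v F => ?_⟩
  have : (∀ w, m v w = F w) ↔ e v = F := by
    rw [LinearMap.ext_iff]; rfl
  rw [this]
  exact (LinearEquiv.eq_symm_apply e).symm

/-- A linear differential-algebraic system with definite mass form `m`, and definite restriction of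
`B` to the algebraic variables, reduces to an explicit linear system. -/
theorem exists_reduction {V W : Type*} [AddCommGroup V] [Module ℝ V]
    [FiniteDimensional ℝ V] [AddCommGroup W] [Module ℝ W] [FiniteDimensional ℝ W]
    (m : V →ₗ[ℝ] V →ₗ[ℝ] ℝ) (hm : ∀ v, m v v = 0 → v = 0)
    (B : (V × W) →ₗ[ℝ] (V × W) →ₗ[ℝ] ℝ) (hB : ∀ w : W, B (0, w) (0, w) = 0 → w = 0) :
    ∃ (R : V →ₗ[ℝ] W) (A : V →ₗ[ℝ] V) (G : (V →ₗ[ℝ] ℝ) →ₗ[ℝ] V), ∀ dc c cb F,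
      (∀ w : V × W, m dc w.1 + B (c, cb) w = F w.1) ↔ cb = R c ∧ dc = A c + G F := by
  obtain ⟨G, hG⟩ := exists_unique_of_definite m hm
  obtain ⟨H, hH⟩ := exists_unique_of_definite
    (B.compl₁₂ (LinearMap.inr ℝ V W) (LinearMap.inr ℝ V W)) hB
  let B₁ := B.compl₁₂ (LinearMap.inl ℝ V W) (LinearMap.inr ℝ V W)
  -- Tested with `(0, w)`, the system reads `B (0, cb) (0, w) = -B (c, 0) (0, w)`. Here `B₁ c` is
  -- the functional without the sign, and `H` inverts the block on `W`.
  let R : V →ₗ[ℝ] W := -(H ∘ₗ B₁)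
  let J : V →ₗ[ℝ] V × W := LinearMap.id.prod R
  refine ⟨R, -(G ∘ₗ B.compl₁₂ J (LinearMap.inl ℝ V W)), G, fun dc c cb F => ?_⟩
  have h1 : (∀ w, B (c, cb) (0, w) = 0) ↔ cb = R c := by
    have := hH cb (-(B₁ c))
    rw [map_neg] at this
    change _ ↔ cb = -(H (B₁ c))
    rw [← this]
    refine forall_congr' fun w => ?_
    have : B (c, cb) (0, w) = B (c, 0) (0, w) + B (0, cb) (0, w) := by
      rw [← LinearMap.add_apply, ← map_add]; simp
    rw [this]
    simp only [B₁, LinearMap.compl₁₂_apply, LinearMap.inl_apply, LinearMap.inr_apply,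
      LinearMap.neg_apply]
    constructor <;> intro h <;> linarith
  have h2 : (∀ w, m dc w + B (c, R c) (w, 0) = F w) ↔
      dc = -(G (B.compl₁₂ J (LinearMap.inl ℝ V W) c)) + G F := by
    rw [neg_add_eq_sub, ← map_sub, ← hG]
    refine forall_congr' fun w => ?_
    have : (B.compl₁₂ J (LinearMap.inl ℝ V W) c) w = B (c, R c) (w, 0) := rfl
    rw [LinearMap.sub_apply, this]
    constructor <;> intro h <;> linarith
  change _ ↔ cb = R c ∧ dc = -(G (B.compl₁₂ J (LinearMap.inl ℝ V W) c)) + G F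
  rw [← h2, ← h1]
  constructor
  · intro h
    have h3 : ∀ w, B (c, cb) (0, w) = 0 := fun w => by simpa using h (0, w)
    refine ⟨h3, fun w => ?_⟩
    rw [← h1.1 h3]
    exact h (w, 0)
  · rintro ⟨h3, h4⟩ ⟨v, w⟩
    have : B (c, cb) (v, w) = B (c, cb) (v, 0) + B (c, cb) (0, w) := by
      rw [← map_add]; simp
    rw [this, h3, add_zero, h1.1 h3]
    exact h4 v

/-! ### Linear systems of ordinary differential equations -/

theorem absolutelyContinuousOnInterval_sum {ι : Type*} (s : Finset ι) {f : ι → ℝ → ℝ} {a b : ℝ}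
    (h : ∀ i ∈ s, AbsolutelyContinuousOnInterval (f i) a b) :
    AbsolutelyContinuousOnInterval (fun t => ∑ i ∈ s, f i t) a b := by
  classical
  induction s using Finset.induction_on with
  | empty =>
    simpa using (contDiff_const (c := (0 : ℝ)) (n := 1)).contDiffOn.absolutelyContinuousOnInterval
  | insert i s hi ih =>
    simp only [Finset.sum_insert hi]
    exact (h i (by simp)).add (ih fun j hj => h j (by simp [hj]))

theorem _root_.AbsolutelyContinuousOnInterval.congr {f g : ℝ → ℝ} {a b : ℝ}
    (hf : AbsolutelyContinuousOnInterval f a b) (h : EqOn f g (uIcc a b)) :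
    AbsolutelyContinuousOnInterval g a b := by
  rw [absolutelyContinuousOnInterval_iff] at hf ⊢
  intro ε hε
  obtain ⟨δ, hδ, H⟩ := hf ε hε
  refine ⟨δ, hδ, fun E hE hE' => ?_⟩
  have := H E hE hE'
  rwa [Finset.sum_congr rfl fun i hi => ?_] at this
  rw [h (hE.1 i hi).1, h (hE.1 i hi).2]

variable {n : ℕ}

theorem hasDerivAt_exp_smul_apply (A : (Fin n → ℝ) →L[ℝ] (Fin n → ℝ)) {y : ℝ → Fin n → ℝ}
    {y' : Fin n → ℝ} {s : Set ℝ} {t : ℝ} (hy : HasDerivWithinAt y y' s t) :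
    HasDerivWithinAt (fun t => NormedSpace.exp (t • A) (y t))
      (NormedSpace.exp (t • A) (A (y t) + y')) s t := by
  have := (hasDerivAt_exp_smul_const (𝕂 := ℝ) A t).hasDerivWithinAt.clm_apply hy (s := s)
  simpa using this

theorem exp_smul_neg_apply (A : (Fin n → ℝ) →L[ℝ] (Fin n → ℝ)) (t : ℝ) (v : Fin n → ℝ) :
    NormedSpace.exp (t • A) (NormedSpace.exp (t • (-A)) v) = v := by
  let _ : NormedAlgebra ℚ ((Fin n → ℝ) →L[ℝ] (Fin n → ℝ)) := NormedAlgebra.restrictScalars ℚ ℝ _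
  have h : NormedSpace.exp (t • A) * NormedSpace.exp (t • (-A)) = 1 := by
    rw [← NormedSpace.exp_add_of_commute (by rw [smul_neg]; exact (Commute.refl (t • A)).neg_right)]
    simp
  change (NormedSpace.exp (t • A) * NormedSpace.exp (t • (-A))) v = v
  rw [h]; rfl

theorem contDiff_exp_smul_apply (A : (Fin n → ℝ) →L[ℝ] (Fin n → ℝ)) (v : Fin n → ℝ) :
    ContDiff ℝ 1 fun t : ℝ => NormedSpace.exp (t • A) v := by
  refine ContDiff.clm_apply ?_ contDiff_const
  rw [contDiff_iff_contDiffAt]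
  intro t
  exact (NormedSpace.exp_analytic (𝕂 := ℝ) (t • A)).contDiffAt.comp t
    (contDiff_id.smul contDiff_const).contDiffAt

/-- Absolute continuity is used here for scalar functions only, so the matrix-vector product is
expanded into a finite sum of `C¹` matrix entries times absolutely continuous components. -/
theorem absolutelyContinuousOnInterval_exp_smul_apply (A : (Fin n → ℝ) →L[ℝ] (Fin n → ℝ))
    {y : ℝ → Fin n → ℝ} {a b : ℝ}
    (hy : ∀ i, AbsolutelyContinuousOnInterval (fun t => y t i) a b) (i : Fin n) :
    AbsolutelyContinuousOnInterval (fun t => NormedSpace.exp (t • A) (y t) i) a b := by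
  have h : ∀ t, NormedSpace.exp (t • A) (y t) i
      = ∑ j, NormedSpace.exp (t • A) (Pi.single j 1) i * y t j := by
    intro t
    conv_lhs => rw [pi_eq_sum_univ' (y t)]
    simp [Finset.sum_apply, mul_comm]
  simp only [h]
  refine absolutelyContinuousOnInterval_sum _ fun j _ => AbsolutelyContinuousOnInterval.mul ?_ (hy j)
  exact (contDiff_pi.1 (contDiff_exp_smul_apply A (Pi.single j 1)) i).contDiffOn
    |>.absolutelyContinuousOnInterval

/-- Uniqueness of absolutely continuous solutions of a linear system. -/
theorem eq_zero_of_ae_hasDerivWithinAt (A : (Fin n → ℝ) →L[ℝ] (Fin n → ℝ)) {y : ℝ → Fin n → ℝ}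
    {T : ℝ} (hT : 0 < T) (h0 : y 0 = 0)
    (hac : ∀ i, AbsolutelyContinuousOnInterval (fun t => y t i) 0 T)
    (hy : ∀ᵐ t ∂(volume.restrict (Ioc 0 T)), HasDerivWithinAt y (A (y t)) (Icc 0 T) t) :
    ∀ t ∈ Icc 0 T, y t = 0 := by
  -- Integrating factor: the derivative `exp(-tA) (-A y + A y)` vanishes almost everywhere, and an
  -- absolutely continuous function with this property is constant.
  have key : ∀ t ∈ Icc 0 T, NormedSpace.exp (t • (-A)) (y t) = 0 := by
    intro t ht
    ext i
    obtain ⟨K, hK⟩ := (absolutelyContinuousOnInterval_exp_smul_apply (-A) hac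
      i).const_of_ae_hasDerivAt_zero (by
      rw [ae_restrict_iff' measurableSet_Ioc] at hy
      -- Both endpoints are discarded as null sets, since a derivative within `[0, T]` is two-sided
      -- only at interior points.
      filter_upwards [hy, Measure.ae_ne volume 0, Measure.ae_ne volume T] with s hs hs0 hsT hsI
      rw [uIcc_of_le hT.le] at hsI
      have hs1 : s ∈ Ioo 0 T := ⟨lt_of_le_of_ne hsI.1 (Ne.symm hs0), lt_of_le_of_ne hsI.2 hsT⟩
      have h2 := (hasDerivAt_exp_smul_apply (-A) (hs ⟨hs1.1, hs1.2.le⟩)).hasDerivAt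
        (Icc_mem_nhds hs1.1 hs1.2)
      simpa using hasDerivAt_pi.1 h2 i)
    rw [uIcc_of_le hT.le] at hK
    rw [hK t ht, ← hK 0 ⟨le_rfl, hT.le⟩, h0]
    simp
  intro t ht
  have := exp_smul_neg_apply A t (y t)
  rw [key t ht, map_zero] at this
  exact this.symm

/-- Uniqueness of classical solutions of a linear system. -/
theorem eq_zero_of_forall_hasDerivWithinAt (A : (Fin n → ℝ) →L[ℝ] (Fin n → ℝ))
    {y : ℝ → Fin n → ℝ} {T : ℝ} (h0 : y 0 = 0) (hc : ContinuousOn y (Icc 0 T))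
    (hy : ∀ t ∈ Ioc 0 T, HasDerivWithinAt y (A (y t)) (Icc 0 T) t) :
    ∀ t ∈ Icc 0 T, y t = 0 := by
  intro t ht
  have key : NormedSpace.exp (t • (-A)) (y t) = 0 := by
    rcases ht.1.eq_or_lt with rfl | ht0
    · simp [h0]
    ext i
    have hcont : ContinuousOn (fun s => NormedSpace.exp (s • (-A)) (y s) i) (Icc 0 t) := by
      have h1 : ContinuousOn (fun s : ℝ => NormedSpace.exp (s • (-A))) (Icc 0 t) := fun s _ =>
        (hasDerivAt_exp_smul_const (𝕂 := ℝ) (-A) s).continuousAt.continuousWithinAt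
      exact continuousOn_pi.1 (h1.clm_apply (hc.mono (Icc_subset_Icc_right ht.2))) i
    -- The mean value theorem on `[0, t]`, one coordinate at a time, needs only continuity at the
    -- left endpoint, where the equation is not assumed.
    obtain ⟨s, hs, hs'⟩ := exists_hasDerivAt_eq_slope _ (fun _ => (0 : ℝ)) ht0 hcont fun s hs => by
      have h2 := (hasDerivAt_exp_smul_apply (-A) (hy s ⟨hs.1, hs.2.le.trans ht.2⟩)).hasDerivAt
        (Icc_mem_nhds hs.1 (hs.2.trans_le ht.2))
      simpa using hasDerivAt_pi.1 h2 i
    rw [eq_comm, div_eq_zero_iff, or_iff_left (by linarith), h0] at hs'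
    simpa using hs'
  have := exp_smul_neg_apply A t (y t)
  rw [key, map_zero] at this
  exact this.symm

/-- Existence of solutions of a linear system with integrable right-hand side. -/
theorem exists_linear_ode_solution (A : (Fin n → ℝ) →L[ℝ] (Fin n → ℝ)) (y₀ : Fin n → ℝ)
    {g : ℝ → Fin n → ℝ} {T : ℝ} (hT : 0 < T) (hg : IntegrableOn g (Ioc 0 T)) :
    ∃ y : ℝ → Fin n → ℝ, y 0 = y₀ ∧
      (∀ i, AbsolutelyContinuousOnInterval (fun t => y t i) 0 T) ∧
      (∀ᵐ t ∂(volume.restrict (Ioc 0 T)), HasDerivWithinAt y (A (y t) + g t) (Icc 0 T) t) ∧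
      (ContinuousOn g (Ioc 0 T) →
        ∀ t ∈ Ioc 0 T, HasDerivWithinAt y (A (y t) + g t) (Icc 0 T) t) := by
  -- The Duhamel integrand, with `g` frozen after time `T`. If `g` is continuous on `(0, T]`, then
  -- `h` is continuous on `(0, ∞)`, so its integral is differentiable at `T` as well.
  let h : ℝ → Fin n → ℝ := fun s => NormedSpace.exp (s • (-A)) (g (min s T))
  have hexp : Continuous fun s : ℝ => NormedSpace.exp (s • (-A)) :=
    continuous_iff_continuousAt.2 fun s =>
      (hasDerivAt_exp_smul_const (𝕂 := ℝ) (-A) s).continuousAt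
  have hgm : ∀ s ∈ Ioc 0 T, g (min s T) = g s := fun s hs => by rw [min_eq_left hs.2]
  have hint : IntervalIntegrable h volume 0 T := by
    rw [intervalIntegrable_iff_integrableOn_Ioc_of_le hT.le]
    have hg' : IntegrableOn (fun s => g (min s T)) (Ioc 0 T) :=
      hg.congr_fun (fun s hs => (hgm s hs).symm) measurableSet_Ioc
    obtain ⟨K, hK⟩ := isCompact_Icc.exists_bound_of_continuousOn
      (hexp.continuousOn (s := Icc 0 T))
    refine Integrable.mono' (hg'.norm.const_mul K) ?_ ?_
    · exact (isBoundedBilinearMap_apply (𝕜 := ℝ) (E := Fin n → ℝ)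
        (F := Fin n → ℝ)).continuous.comp_aestronglyMeasurable
        (hexp.aestronglyMeasurable.prodMk hg'.1)
    · rw [ae_restrict_iff' measurableSet_Ioc]
      refine Filter.Eventually.of_forall fun s hs => ?_
      exact ((NormedSpace.exp (s • (-A))).le_opNorm _).trans
        (mul_le_mul_of_nonneg_right (hK s ⟨hs.1.le, hs.2⟩) (norm_nonneg _))
  let I : ℝ → Fin n → ℝ := fun t => y₀ + ∫ s in (0 : ℝ)..t, h s
  have hderiv : ∀ t ∈ Ioc 0 T, HasDerivAt (fun t => ∫ s in (0 : ℝ)..t, h s) (h t) t →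
      HasDerivWithinAt (fun t => NormedSpace.exp (t • A) (I t))
        (A (NormedSpace.exp (t • A) (I t)) + g t) (Icc 0 T) t := by
    intro t ht hd
    have h1 := hasDerivAt_exp_smul_apply A (hd.const_add y₀).hasDerivWithinAt (s := Icc 0 T)
    convert! h1 using 1
    rw [map_add (NormedSpace.exp (t • A)) (A _)]
    congr 1
    · have : Commute A (NormedSpace.exp (t • A)) :=
        ((Commute.refl A).smul_right t).exp_right
      exact congrArg (fun L : (Fin n → ℝ) →L[ℝ] (Fin n → ℝ) => L (I t)) this.eq
    · rw [← hgm t ht]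
      exact (exp_smul_neg_apply A t _).symm
  refine ⟨fun t => NormedSpace.exp (t • A) (I t), by simp [I], ?_, ?_, ?_⟩
  · refine absolutelyContinuousOnInterval_exp_smul_apply A fun i => ?_
    have h1 : ∀ t ∈ uIcc 0 T, (∫ s in (0 : ℝ)..t, h s) i = ∫ s in (0 : ℝ)..t, h s i := by
      intro t ht
      have := ContinuousLinearMap.intervalIntegral_comp_comm
        (ContinuousLinearMap.proj (R := ℝ) (φ := fun _ : Fin n => ℝ) i)
        (hint.mono_set (uIcc_subset_uIcc_left ht))
      exact this.symm
    have h2 : IntervalIntegrable (fun s => h s i) volume 0 T :=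
      ⟨hint.1.eval i, hint.2.eval i⟩
    have h3 := (h2.absolutelyContinuousOnInterval_intervalIntegral (c := 0) (by simp)).add
      (contDiff_const (c := y₀ i) (n := 1)).contDiffOn.absolutelyContinuousOnInterval
    refine h3.congr fun t ht => ?_
    change (∫ s in (0 : ℝ)..t, h s i) + y₀ i = (y₀ + ∫ s in (0 : ℝ)..t, h s) i
    rw [Pi.add_apply, h1 t ht, add_comm]
  · rw [ae_restrict_iff' measurableSet_Ioc]
    filter_upwards [hint.ae_hasDerivAt_integral] with t ht htI
    refine hderiv t htI (ht ?_ 0 (by simp))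
    rw [uIcc_of_le hT.le]; exact ⟨htI.1.le, htI.2⟩
  · intro hgc t ht
    refine hderiv t ht ?_
    have hcont : ContinuousOn h (Ioi 0) := by
      refine hexp.continuousOn.clm_apply (hgc.comp (by fun_prop) fun s hs => ?_)
      exact ⟨lt_min hs hT, min_le_right _ _⟩
    refine intervalIntegral.integral_hasDerivAt_right
      (hint.mono_set (uIcc_subset_uIcc_left ?_))
      (hcont.stronglyMeasurableAtFilter isOpen_Ioi t ht.1)
      (hcont.continuousAt (Ioi_mem_nhds ht.1))
    rw [uIcc_of_le hT.le]; exact ⟨ht.1.le, ht.2⟩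

end

section
variable {d k : ℕ}

/-! ### Polynomials -/

theorem exists_mvPolynomial_of_mem_polyFun {p : Euc d → ℝ} (hp : p ∈ polyFun d k) :
    ∃ P : MvPolynomial (Fin d) ℝ, ∀ x, p x = MvPolynomial.aeval (fun i => x i) P := by
  obtain ⟨P, -, rfl⟩ := hp
  exact ⟨P, fun _ => rfl⟩

theorem contDiff_of_mem_polyFun {p : Euc d → ℝ} (hp : p ∈ polyFun d k) : ContDiff ℝ 1 p := by
  obtain ⟨P, hP⟩ := exists_mvPolynomial_of_mem_polyFun hp
  rw [funext hP]
  clear hP hp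
  induction P using MvPolynomial.induction_on with
  | C a => simpa using contDiff_const
  | add p q hp hq => simpa using hp.add hq
  | mul_X p i hp =>
    simp only [map_mul, MvPolynomial.aeval_X]
    exact hp.mul (by fun_prop)

theorem continuous_of_mem_polyFun {p : Euc d → ℝ} (hp : p ∈ polyFun d k) : Continuous p :=
  (contDiff_of_mem_polyFun hp).continuous

theorem continuous_gradient_of_mem_polyFun {p : Euc d → ℝ} (hp : p ∈ polyFun d k) :
    Continuous (gradient p) :=
  (InnerProductSpace.toDual ℝ (Euc d)).symm.continuous.comp
    ((contDiff_of_mem_polyFun hp).continuous_fderiv one_ne_zero)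

instance : FiniteDimensional ℝ (polyFun d k) := by
  have : FiniteDimensional ℝ (MvPolynomial.restrictTotalDegree (Fin d) ℝ k) := inferInstance
  unfold polyFun
  infer_instance

theorem eq_zero_of_mem_polyFun {p : Euc d → ℝ} (hp : p ∈ polyFun d k) {s : Set (Euc d)}
    (hs : (interior s).Nonempty) (h : ∀ x ∈ s, p x = 0) : p = 0 := by
  obtain ⟨P, hP⟩ := exists_mvPolynomial_of_mem_polyFun hp
  obtain ⟨x, hx⟩ := hs
  have ho : IsOpen ((EuclideanSpace.equiv (Fin d) ℝ).symm ⁻¹' interior s) :=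
    isOpen_interior.preimage (EuclideanSpace.equiv (Fin d) ℝ).symm.continuous
  obtain ⟨ε, hε, hb⟩ := Metric.isOpen_iff.1 ho (EuclideanSpace.equiv (Fin d) ℝ x) (by simpa using hx)
  have h0 : P = 0 := by
    -- In sup-norm coordinates a ball is a product of intervals, and a polynomial vanishing on a
    -- product of infinite sets is formally zero.
    refine MvPolynomial.funext_set (fun i => Metric.ball (x i) ε) (fun i => ?_) fun y hy => ?_
    · rw [Real.ball_eq_Ioo]
      exact Ioo_infinite (by linarith)
    · have hy' : y ∈ Metric.ball (EuclideanSpace.equiv (Fin d) ℝ x) ε := by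
        rw [ball_pi _ hε]; exact hy
      have := h _ (interior_subset (hb hy'))
      rw [hP] at this
      simpa [MvPolynomial.aeval_eq_eval] using this
  ext y
  simp [hP, h0]

/-! ### Simplices and facets -/

theorem isCompact_hull (S : Finset (Euc d)) : IsCompact (hull S) :=
  S.finite_toSet.isCompact_convexHull (𝕜 := ℝ)

theorem measurableSet_hull (S : Finset (Euc d)) : MeasurableSet (hull S) :=
  (isCompact_hull S).isClosed.measurableSet

theorem IsSimplex.interior_hull_nonempty {S : Finset (Euc d)} (hS : IsSimplex S) :
    (interior (hull S)).Nonempty := by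
  rw [hull, interior_convexHull_nonempty_iff_affineSpan_eq_top]
  have := (hS.2.affineSpan_eq_top_iff_card_eq_finrank_add_one).2 (by simp [hS.1])
  simpa using this

/-- If a nonnegative continuous function on a compact convex set with interior has zero integral,
it vanishes. -/
theorem eqOn_zero_of_setIntegral_eq_zero {m : ℕ} {s : Set (Euc m)} (hc : IsCompact s)
    (hs : Convex ℝ s) (hi : (interior s).Nonempty) {g : Euc m → ℝ} (hg : ContinuousOn g s)
    (h0 : ∀ x ∈ s, 0 ≤ g x) (h : ∫ x in s, g x = 0) : ∀ x ∈ s, g x = 0 := by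
  have hae := (setIntegral_eq_zero_iff_of_nonneg_ae ((ae_restrict_iff' hc.isClosed.measurableSet).2
    (Filter.Eventually.of_forall h0)) (hg.integrableOn_compact hc)).1 h
  -- Almost everywhere becomes everywhere by continuity, since a convex set with nonempty interior
  -- lies in the closure of that interior.
  refine Measure.eqOn_of_ae_eq hae hg continuousOn_const ?_
  rw [hs.closure_interior_eq_closure_of_nonempty_interior hi]
  exact subset_closure

/-- A nondegenerate `m`-simplex in `ℝ^d` is the isometric image of one in `ℝ^m`. -/
theorem exists_isometry_hull {m : ℕ} {F : Finset (Euc d)} (hcard : F.card = m + 1)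
    (hF : AffineIndependent ℝ ((↑) : F → Euc d)) :
    ∃ (φ : Euc m → Euc d) (K : Set (Euc m)), Isometry φ ∧ IsCompact K ∧ Convex ℝ K ∧
      (interior K).Nonempty ∧ φ '' K = hull F := by
  have hfin : Module.finrank ℝ (vectorSpan ℝ (F : Set (Euc d))) = m := by
    have := hF.finrank_vectorSpan (n := m) (by simpa using hcard)
    rwa [Subtype.range_coe_subtype] at this
  obtain ⟨p, hp⟩ : F.Nonempty := Finset.card_pos.1 (by omega)
  -- Orthonormal coordinates on the direction of the affine span of `F`; translating by the vertex
  -- `p` gives the isometry `φ`, and `K` is the hull of the pulled-back vertices.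
  let L : Euc m ≃ₗᵢ[ℝ] vectorSpan ℝ (F : Set (Euc d)) :=
    ((stdOrthonormalBasis ℝ _).reindex (finCongr hfin)).repr.symm
  let φ : Euc m →ᵃⁱ[ℝ] Euc d := (AffineIsometryEquiv.vaddConst ℝ p).toAffineIsometry.comp
    ((vectorSpan ℝ (F : Set (Euc d))).subtypeₗᵢ.comp L.toLinearIsometry).toAffineIsometry
  have hφ : ∀ y, φ y = (L y : Euc d) + p := fun y => rfl
  have hrange : ∀ x ∈ affineSpan ℝ (F : Set (Euc d)), x ∈ range φ := by
    intro x hx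
    have : x - p ∈ vectorSpan ℝ (F : Set (Euc d)) := by
      rw [← direction_affineSpan]
      exact AffineSubspace.vsub_mem_direction hx (subset_affineSpan ℝ _ hp)
    exact ⟨L.symm ⟨x - p, this⟩, by simp [hφ]⟩
  let F' : Set (Euc m) := φ ⁻¹' F
  have himg : φ '' F' = F :=
    image_preimage_eq_of_subset fun x hx => hrange x (subset_affineSpan ℝ _ hx)
  have hF'fin : F'.Finite := F.finite_toSet.preimage φ.injective.injOn
  refine ⟨φ, convexHull ℝ F', φ.isometry, hF'fin.isCompact_convexHull (𝕜 := ℝ), convex_convexHull ℝ _, ?_, ?_⟩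
  · rw [interior_convexHull_nonempty_iff_affineSpan_eq_top]
    have h1 : (affineSpan ℝ F').map φ.toAffineMap = affineSpan ℝ (F : Set (Euc d)) := by
      rw [AffineSubspace.map_span]; exact congrArg _ himg
    rw [eq_top_iff]
    intro y _
    have h2 : φ y ∈ affineSpan ℝ (F : Set (Euc d)) := by
      have h3 := AffineSubspace.vadd_mem_of_mem_direction
        (s := affineSpan ℝ (F : Set (Euc d))) (v := (L y : Euc d))
        (by rw [direction_affineSpan]; exact (L y).2) (subset_affineSpan ℝ _ hp)
      exact h3
    rw [← h1] at h2
    obtain ⟨z, hz, hzy⟩ := h2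
    rwa [← φ.injective hzy]
  · have := φ.toAffineMap.image_convexHull F'
    refine this.trans ?_
    exact congrArg _ himg

/-- The normalised Hausdorff measure is preserved by isometries and equals Lebesgue measure in its
own dimension, so facet integrals become integrals over a convex body. -/
theorem setIntegral_isometry_image {m : ℕ} {φ : Euc m → Euc d} (hφ : Isometry φ) {K : Set (Euc m)}
    (g : Euc d → ℝ) : ∫ x in φ '' K, g x ∂(μHE[m]) = ∫ y in K, g (φ y) := by
  have he : MeasurableEmbedding φ := hφ.isClosedEmbedding.measurableEmbedding
  rw [← EuclideanSpace.euclideanHausdorffMeasure_eq_volume]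
  have h1 := hφ.map_euclideanHausdorffMeasure (d := m)
  have h2 : (μHE[m] : Measure (Euc d)).restrict (φ '' K)
      = (Measure.map φ μHE[m]).restrict (φ '' K) := by
    rw [h1, Measure.restrict_restrict_of_subset (image_subset_range _ _)]
  rw [h2, he.setIntegral_map, preimage_image_eq _ hφ.injective]

theorem measure_hull_lt_top {m : ℕ} {F : Finset (Euc d)} (hcard : F.card = m + 1)
    (hF : AffineIndependent ℝ ((↑) : F → Euc d)) : μHE[m] (hull F) < ⊤ := by
  obtain ⟨φ, K, hφ, hK, -, -, hKF⟩ := exists_isometry_hull hcard hF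
  rw [← hKF, hφ.euclideanHausdorffMeasure_image, EuclideanSpace.euclideanHausdorffMeasure_eq_volume]
  exact hK.measure_lt_top

theorem eqOn_zero_of_setIntegral_hull_eq_zero {m : ℕ} {F : Finset (Euc d)} (hcard : F.card = m + 1)
    (hF : AffineIndependent ℝ ((↑) : F → Euc d)) {g : Euc d → ℝ} (hg : ContinuousOn g (hull F))
    (h0 : ∀ x ∈ hull F, 0 ≤ g x) (h : ∫ x in hull F, g x ∂(μHE[m]) = 0) :
    ∀ x ∈ hull F, g x = 0 := by
  obtain ⟨φ, K, hφ, hK, hconv, hint, hKF⟩ := exists_isometry_hull hcard hF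
  rw [← hKF] at hg h0 h ⊢
  rw [setIntegral_isometry_image hφ] at h
  have := eqOn_zero_of_setIntegral_eq_zero hK hconv hint
    (hg.comp hφ.continuous.continuousOn (mapsTo_image φ K)) (fun y hy => h0 _ ⟨y, hy, rfl⟩) h
  rintro _ ⟨y, hy, rfl⟩
  exact this y hy

theorem IsSimplex.card_facet {S : Finset (Euc d)} (hS : IsSimplex S) {v : Euc d} (hv : v ∈ S) :
    (facet S v).card = d := by
  classical
  rw [facet, Finset.card_erase_of_mem hv, hS.1]; rfl

theorem facet_subset (S : Finset (Euc d)) (v : Euc d) : facet S v ⊆ S := by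
  classical
  exact Finset.erase_subset v S

theorem IsSimplex.affineIndependent_facet {S : Finset (Euc d)} (hS : IsSimplex S) (v : Euc d) :
    AffineIndependent ℝ ((↑) : facet S v → Euc d) :=
  hS.2.mono (facet_subset S v)

/-- If the vector being normalised were zero, `v` would differ from the facet centroid by a
direction of the facet, hence lie in its affine span, against affine independence. Unit length is
what turns coercivity into the bound `D n ⋅ n ≥ Dmin`. -/
theorem IsSimplex.norm_outwardNormal {S : Finset (Euc d)} (hd : 0 < d) (hS : IsSimplex S)
    {v : Euc d} (hv : v ∈ S) : ‖outwardNormal S v‖ = 1 := by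
  classical
  rw [outwardNormal]
  refine norm_smul_inv_norm (𝕜 := ℝ) fun h => ?_
  rw [Submodule.starProjection_apply, Submodule.coe_eq_zero,
    Submodule.orthogonalProjectionOnto_eq_zero_iff, Submodule.orthogonal_orthogonal,
    ← direction_affineSpan] at h
  have hc : (facet S v).centroid ℝ id ∈ affineSpan ℝ (facet S v : Set (Euc d)) := by
    have := affineCombination_mem_affineSpan_image
      ((facet S v).sum_centroidWeights_eq_one_of_card_ne_zero ℝ
        (by rw [hS.card_facet hv]; omega)) (s' := (facet S v : Set (Euc d)))
      (fun i hi hi' => absurd hi hi') (id : Euc d → Euc d)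
    rwa [image_id] at this
  have hv' : v ∈ affineSpan ℝ (facet S v : Set (Euc d)) := by
    have := AffineSubspace.vadd_mem_of_mem_direction (Submodule.neg_mem _ h) hc
    simpa using this
  refine hS.2.notMem_affineSpan_sdiff ⟨v, hv⟩ univ ?_
  convert! hv' using 3
  ext x
  simp [facet, and_comm]

end

section

/-! ### Bilinear expressions -/

section Bilinear

variable {X Y : Type*} [AddCommGroup X] [Module ℝ X] [AddCommGroup Y] [Module ℝ Y]

/-- The function `b` of two arguments is bilinear. -/
def IsBilin (b : X → Y → ℝ) : Prop := ∃ L : X →ₗ[ℝ] Y →ₗ[ℝ] ℝ, ∀ x y, L x y = b x y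

namespace IsBilin

theorem add {b c : X → Y → ℝ} (hb : IsBilin b) (hc : IsBilin c) :
    IsBilin fun x y => b x y + c x y := by
  obtain ⟨L, hL⟩ := hb
  obtain ⟨M, hM⟩ := hc
  exact ⟨L + M, fun x y => by simp [hL, hM]⟩

theorem const_mul {b : X → Y → ℝ} (r : ℝ) (hb : IsBilin b) : IsBilin fun x y => r * b x y := by
  obtain ⟨L, hL⟩ := hb
  exact ⟨r • L, fun x y => by simp [hL]⟩

theorem neg {b : X → Y → ℝ} (hb : IsBilin b) : IsBilin fun x y => -b x y := by
  simpa using hb.const_mul (-1)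

theorem sub {b c : X → Y → ℝ} (hb : IsBilin b) (hc : IsBilin c) :
    IsBilin fun x y => b x y - c x y := by
  simpa [sub_eq_add_neg] using hb.add hc.neg

theorem sum {ι : Type*} (s : Finset ι) {b : ι → X → Y → ℝ} (hb : ∀ i ∈ s, IsBilin (b i)) :
    IsBilin fun x y => ∑ i ∈ s, b i x y := by
  classical
  choose! L hL using hb
  refine ⟨∑ i ∈ s, L i, fun x y => ?_⟩
  simp only [LinearMap.sum_apply]
  exact Finset.sum_congr rfl fun i hi => hL i hi x y

/-- Pointwise bilinearity does not suffice: additivity of the integral requires every `Φ x y` to be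
integrable. -/
theorem integral {α : Type*} [MeasurableSpace α] {ν : Measure α} {Φ : X → Y → α → ℝ}
    (h : ∀ a, IsBilin fun x y => Φ x y a) (hi : ∀ x y, Integrable (Φ x y) ν) :
    IsBilin fun x y => ∫ a, Φ x y a ∂ν := by
  choose L hL using h
  refine ⟨LinearMap.mk₂ ℝ (fun x y => ∫ a, Φ x y a ∂ν) ?_ ?_ ?_ ?_, fun _ _ => rfl⟩
  · intro x x' y
    rw [← integral_add (hi x y) (hi x' y)]
    simp [← hL]
  · intro r x y
    rw [← integral_smul]
    simp [← hL]
  · intro x y y'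
    rw [← integral_add (hi x y) (hi x y')]
    simp [← hL]
  · intro r x y
    rw [← integral_smul]
    simp [← hL]

theorem inner {E : Type*} [NormedAddCommGroup E] [InnerProductSpace ℝ E] {f : X → E} {g : Y → E}
    (hf : IsLinearMap ℝ f) (hg : IsLinearMap ℝ g) :
    IsBilin fun x y => inner ℝ (f x) (g y) :=
  ⟨(innerₗ E).compl₁₂ hf.mk' hg.mk', fun _ _ => rfl⟩

theorem mul {f : X → ℝ} {g : Y → ℝ} (hf : IsLinearMap ℝ f) (hg : IsLinearMap ℝ g) :
    IsBilin fun x y => f x * g y :=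
  ⟨(LinearMap.mul ℝ ℝ).compl₁₂ hf.mk' hg.mk', fun _ _ => rfl⟩

theorem mul_swap {f : X → ℝ} {g : Y → ℝ} (hf : IsLinearMap ℝ f) (hg : IsLinearMap ℝ g) :
    IsBilin fun x y => g y * f x := by
  simpa only [mul_comm] using mul hf hg

end IsBilin

theorem _root_.IsLinearMap.clm_comp {E F : Type*} [NormedAddCommGroup E] [NormedSpace ℝ E]
    [NormedAddCommGroup F] [NormedSpace ℝ F] {f : X → E} (hf : IsLinearMap ℝ f) (L : E →L[ℝ] F) :
    IsLinearMap ℝ fun x => L (f x) :=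
  (L.toLinearMap ∘ₗ hf.mk').isLinear

theorem _root_.IsLinearMap.inner_const {E : Type*} [NormedAddCommGroup E] [InnerProductSpace ℝ E]
    {f : X → E} (hf : IsLinearMap ℝ f) (n : E) : IsLinearMap ℝ fun x => inner ℝ (f x) n :=
  ⟨fun x y => by rw [hf.map_add, inner_add_left],
    fun r x => by rw [hf.map_smul, real_inner_smul_left, smul_eq_mul]⟩

end Bilinear

/-! ### Integrals over element boundaries -/

variable {d ℓ : ℕ}

theorem IsSimplex.integrableOn_facet {S : Finset (Euc d)} (hd : 0 < d) (hS : IsSimplex S)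
    {v : Euc d} (hv : v ∈ S) {g : Euc d → ℝ} (hg : ContinuousOn g (hull (facet S v))) :
    IntegrableOn g (hull (facet S v)) (μHE[d - 1]) := by
  obtain ⟨K, hK⟩ := (isCompact_hull _).exists_bound_of_continuousOn hg
  refine IntegrableOn.of_bound
    (measure_hull_lt_top (by rw [hS.card_facet hv]; omega) (hS.affineIndependent_facet v))
    (hg.aestronglyMeasurable (measurableSet_hull _)) K ?_
  exact (ae_restrict_iff' (measurableSet_hull _)).2 (Filter.Eventually.of_forall hK)

theorem IsSimplex.eqOn_zero_of_facetInt_eq_zero {S : Finset (Euc d)} (hd : 0 < d)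
    (hS : IsSimplex S) {v : Euc d} (hv : v ∈ S) {g : Euc d → ℝ}
    (hg : ContinuousOn g (hull (facet S v))) (h0 : ∀ x ∈ hull (facet S v), 0 ≤ g x)
    (h : facetInt (facet S v) g = 0) : ∀ x ∈ hull (facet S v), g x = 0 :=
  eqOn_zero_of_setIntegral_hull_eq_zero (by rw [hS.card_facet hv]; omega)
    (hS.affineIndependent_facet v) hg h0 h

theorem IsBilin.bdryInt {X Y : Type*} [AddCommGroup X] [Module ℝ X] [AddCommGroup Y] [Module ℝ Y]
    {S : Finset (Euc d)} {Φ : X → Y → Finset (Euc d) → Euc d → Euc d → ℝ}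
    (h : ∀ F n a, IsBilin fun x y => Φ x y F n a)
    (hi : ∀ x y, ∀ v ∈ S, ∀ n, IntegrableOn (Φ x y (facet S v) n) (hull (facet S v)) (μHE[d - 1])) :
    IsBilin fun x y => bdryInt S (Φ x y) :=
  IsBilin.sum _ fun v hv => IsBilin.integral (fun a => h _ _ a) fun x y => hi x y v hv _

/-! ### The discrete spaces -/

variable {Ω : SplitDomain d} {𝒯 : Mesh Ω}

theorem Ch.mem_polyFun (c : Ch 𝒯 ℓ) (K : 𝒯.Cell) : c.1 K ∈ polyFun d ℓ := c.2 K (mem_univ K)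

theorem Mesh.isSimplex_cell (K : 𝒯.Cell) : IsSimplex K.2.1 := 𝒯.isSimplex _ _ K.2.2

theorem Mesh.facet_mem_facets (K : 𝒯.Cell) {v : Euc d} (hv : v ∈ K.2.1) :
    facet K.2.1 v ∈ 𝒯.facets K.1 := ⟨_, K.2.2, v, hv, rfl⟩

theorem Mesh.hull_facet_subset_skeleton (K : 𝒯.Cell) {v : Euc d} (hv : v ∈ K.2.1) :
    hull (facet K.2.1 v) ⊆ 𝒯.skeleton := fun _ hx =>
  mem_iUnion.2 ⟨K.1, mem_iUnion₂.2 ⟨_, Mesh.facet_mem_facets K hv, hx⟩⟩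

theorem Mesh.exists_mem_hull_facet {x : Euc d} (hx : x ∈ 𝒯.skeleton) :
    ∃ (K : 𝒯.Cell) (v : Euc d), v ∈ K.2.1 ∧ x ∈ hull (facet K.2.1 v) := by
  obtain ⟨j, hj⟩ := mem_iUnion.1 hx
  obtain ⟨_, ⟨S, hS, v, hv, rfl⟩, hxF⟩ := mem_iUnion₂.1 hj
  exact ⟨⟨j, S, hS⟩, v, hv, hxF⟩

theorem Cbar.continuousOn_facet (c : Cbar 𝒯 ℓ) (K : 𝒯.Cell) {v : Euc d} (hv : v ∈ K.2.1) :
    ContinuousOn c.1 (hull (facet K.2.1 v)) :=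
  c.2.1.mono (Mesh.hull_facet_subset_skeleton K hv)

/-- The convention of extension by zero is used here: nothing off the skeleton remains to be
checked. -/
theorem Cbar.eq_zero (c : Cbar 𝒯 ℓ)
    (h : ∀ K : 𝒯.Cell, ∀ v ∈ K.2.1, ∀ x ∈ hull (facet K.2.1 v), c.1 x = 0) : c = 0 := by
  ext x
  by_cases hx : x ∈ 𝒯.skeleton
  · obtain ⟨K, v, hv, hxv⟩ := Mesh.exists_mem_hull_facet hx
    exact h K v hv x hxv
  · exact c.2.2.2 x hx

instance : FiniteDimensional ℝ (Ch 𝒯 ℓ) := by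
  let L : Ch 𝒯 ℓ →ₗ[ℝ] 𝒯.Cell → polyFun d ℓ := LinearMap.pi fun K =>
    ((LinearMap.proj K).comp (Ch 𝒯 ℓ).subtype).codRestrict _ fun c => Ch.mem_polyFun c K
  refine Module.Finite.of_injective L fun a b h => ?_
  ext K x
  exact congrFun (congrArg Subtype.val (congrFun h K)) x

/-- Restriction to all facets is injective, with values in restrictions of polynomials. The target
uses the image of `polyFun` under restriction because different polynomials may agree on a facet. -/
instance : FiniteDimensional ℝ (Cbar 𝒯 ℓ) := by
  let P : (Σ K : 𝒯.Cell, K.2.1) → Submodule ℝ (Euc d → ℝ) := fun _ => polyFun d ℓ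
  let r : ∀ i : (Σ K : 𝒯.Cell, K.2.1), (Euc d → ℝ) →ₗ[ℝ] (hull (facet i.1.2.1 i.2.1) → ℝ) :=
    fun i => LinearMap.funLeft ℝ ℝ Subtype.val
  let L : Cbar 𝒯 ℓ →ₗ[ℝ] ∀ i : (Σ K : 𝒯.Cell, K.2.1), (polyFun d ℓ).map (r i) :=
    LinearMap.pi fun i => ((r i).comp (Cbar 𝒯 ℓ).subtype).codRestrict _ fun c => by
      obtain ⟨q, hq, hcq⟩ := c.2.2.1 _ _ (Mesh.facet_mem_facets i.1 i.2.2)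
      exact ⟨q, hq, funext fun x => (hcq x.2).symm⟩
  refine Module.Finite.of_injective L ((injective_iff_map_eq_zero L).2 fun c hc => ?_)
  refine Cbar.eq_zero c fun K v hv x hx => ?_
  exact congrFun (congrArg Subtype.val (congrFun hc ⟨K, v, hv⟩)) ⟨x, hx⟩

theorem isLinearMap_eval (K : 𝒯.Cell) (x : Euc d) :
    IsLinearMap ℝ fun c : Ch 𝒯 ℓ × Cbar 𝒯 ℓ => c.1.1 K x :=
  ⟨fun _ _ => rfl, fun _ _ => rfl⟩

theorem isLinearMap_jump (K : 𝒯.Cell) (x : Euc d) :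
    IsLinearMap ℝ fun c : Ch 𝒯 ℓ × Cbar 𝒯 ℓ => c.1.1 K x - c.2.1 x :=
  ⟨fun _ _ => add_sub_add_comm _ _ _ _, fun r _ => (mul_sub r _ _).symm⟩

theorem isLinearMap_gradient (K : 𝒯.Cell) (x : Euc d) :
    IsLinearMap ℝ fun c : Ch 𝒯 ℓ × Cbar 𝒯 ℓ => gradient (c.1.1 K) x := by
  have hd : ∀ c : Ch 𝒯 ℓ × Cbar 𝒯 ℓ, DifferentiableAt ℝ (c.1.1 K) x := fun c =>
    (contDiff_of_mem_polyFun (Ch.mem_polyFun c.1 K)).differentiable one_ne_zero x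
  refine ⟨fun a b => ?_, fun r a => ?_⟩
  · simp only [gradient]
    rw [← map_add, ← fderiv_add (hd a) (hd b)]; rfl
  · simp only [gradient]
    rw [← map_smul, ← fderiv_const_smul (hd a)]; rfl

/-! ### The transport forms -/

theorem isBilin_advForm (hd : 0 < d) {u : 𝒯.Cell → Euc d → Euc d} (hu : ∀ K, Continuous (u K)) :
    IsBilin fun a b : Ch 𝒯 ℓ × Cbar 𝒯 ℓ => advForm u a.1.1 a.2.1 b.1.1 b.2.1 := by
  have hp := fun (a : Ch 𝒯 ℓ × Cbar 𝒯 ℓ) K => continuous_of_mem_polyFun (Ch.mem_polyFun a.1 K)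
  have hg := fun (a : Ch 𝒯 ℓ × Cbar 𝒯 ℓ) K =>
    continuous_gradient_of_mem_polyFun (Ch.mem_polyFun a.1 K)
  have hj : ∀ (a : Ch 𝒯 ℓ × Cbar 𝒯 ℓ) (K : 𝒯.Cell) (v : Euc d), v ∈ K.2.1 →
      ContinuousOn (fun x => a.1.1 K x - a.2.1 x) (hull (facet K.2.1 v)) := fun a K v hv =>
    (hp a K).continuousOn.sub (Cbar.continuousOn_facet a.2 K hv)
  refine IsBilin.sub (IsBilin.add (IsBilin.neg (IsBilin.sum _ fun K _ => ?_))
    (IsBilin.sum _ fun K _ => ?_)) (IsBilin.sum _ fun K _ => ?_)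
  · refine IsBilin.integral (fun x => IsBilin.mul (isLinearMap_eval K x) ?_) fun a b => ?_
    · exact (isLinearMap_gradient K x).clm_comp (innerSL ℝ (u K x))
    · exact ((hp a K).mul ((hu K).inner (hg b K))).continuousOn.integrableOn_compact
        (isCompact_hull _)
  · refine IsBilin.bdryInt (fun F n x => IsBilin.mul ?_ (isLinearMap_jump K x))
      fun a b v hv n => ?_
    · exact ⟨fun _ _ => add_mul _ _ _, fun _ _ => mul_assoc _ _ _⟩
    · exact (Mesh.isSimplex_cell K).integrableOn_facet hd hv
        (((hp a K).mul ((hu K).inner continuous_const)).continuousOn.mul (hj b K v hv))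
  · refine IsBilin.bdryInt (fun F n x => ?_) fun a b v hv n => ?_
    -- The inflow set depends on `u` alone, so at each point the indicator is a fixed factor and
    -- bilinearity is not lost.
    · by_cases hx : inner ℝ (u K x) n < 0
      · simp only [indicator, mem_ofPred_eq, hx, if_true, mul_assoc]
        exact (IsBilin.mul (isLinearMap_jump K x) (isLinearMap_jump K x)).const_mul _
      · simp only [indicator, mem_ofPred_eq, hx, if_false]
        exact ⟨0, fun _ _ => rfl⟩
    · refine IntegrableOn.indicator ?_ ?_
      · exact (Mesh.isSimplex_cell K).integrableOn_facet hd hv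
          ((((hu K).inner continuous_const).continuousOn.mul (hj a K v hv)).mul (hj b K v hv))
      · exact (isOpen_lt ((hu K).inner continuous_const) continuous_const).measurableSet

theorem isBilin_diffForm (hd : 0 < d) {u : 𝒯.Cell → Euc d → Euc d} (hu : ∀ K, Continuous (u K))
    {D : Euc d → Euc d →L[ℝ] Euc d} (hD : Continuous D) (βc : ℝ) :
    IsBilin fun a b : Ch 𝒯 ℓ × Cbar 𝒯 ℓ => diffForm D βc u a.1.1 a.2.1 b.1.1 b.2.1 := by
  have hp := fun (a : Ch 𝒯 ℓ × Cbar 𝒯 ℓ) K => continuous_of_mem_polyFun (Ch.mem_polyFun a.1 K)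
  have hg := fun (a : Ch 𝒯 ℓ × Cbar 𝒯 ℓ) K =>
    continuous_gradient_of_mem_polyFun (Ch.mem_polyFun a.1 K)
  have hj : ∀ (a : Ch 𝒯 ℓ × Cbar 𝒯 ℓ) (K : 𝒯.Cell) (v : Euc d), v ∈ K.2.1 →
      ContinuousOn (fun x => a.1.1 K x - a.2.1 x) (hull (facet K.2.1 v)) := fun a K v hv =>
    (hp a K).continuousOn.sub (Cbar.continuousOn_facet a.2 K hv)
  have hDu : ∀ K, Continuous fun x => D (u K x) := fun K => hD.comp (hu K)
  have hflux : ∀ (K : 𝒯.Cell) (n x : Euc d), IsLinearMap ℝ fun a : Ch 𝒯 ℓ × Cbar 𝒯 ℓ =>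
      inner ℝ (D (u K x) (gradient (a.1.1 K) x)) n := fun K n x =>
    ((isLinearMap_gradient K x).clm_comp (D (u K x))).inner_const n
  have hfluxc : ∀ (a : Ch 𝒯 ℓ × Cbar 𝒯 ℓ) (K : 𝒯.Cell) (n : Euc d), Continuous fun x =>
      inner ℝ (D (u K x) (gradient (a.1.1 K) x)) n := fun a K n =>
    ((hDu K).clm_apply (hg a K)).inner continuous_const
  refine IsBilin.sub (IsBilin.add (IsBilin.sub (IsBilin.sum _ fun K _ => ?_)
    (IsBilin.sum _ fun K _ => ?_)) (IsBilin.sum _ fun K _ => ?_)) (IsBilin.sum _ fun K _ => ?_)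
  · refine IsBilin.integral (fun x => IsBilin.inner ((isLinearMap_gradient K x).clm_comp _)
      (isLinearMap_gradient K x)) fun a b => ?_
    exact (((hDu K).clm_apply (hg a K)).inner (hg b K)).continuousOn.integrableOn_compact
      (isCompact_hull _)
  · refine IsBilin.bdryInt (fun F n x => IsBilin.mul (hflux K n x) (isLinearMap_jump K x))
      fun a b v hv n => ?_
    exact (Mesh.isSimplex_cell K).integrableOn_facet hd hv
      ((hfluxc a K n).continuousOn.mul (hj b K v hv))
  · refine IsBilin.const_mul _ (IsBilin.bdryInt (fun F n x => IsBilin.inner ?_ ?_)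
      fun a b v hv n => ?_)
    · exact (isLinearMap_jump K x).clm_comp (ContinuousLinearMap.toSpanSingleton ℝ (D (u K x) n))
    · exact (isLinearMap_jump K x).clm_comp (ContinuousLinearMap.toSpanSingleton ℝ n)
    · exact (Mesh.isSimplex_cell K).integrableOn_facet hd hv
        (((hj a K v hv).smul ((hDu K).clm_apply continuous_const).continuousOn).inner
          ((hj b K v hv).smul continuousOn_const))
  · refine IsBilin.bdryInt (fun F n x => IsBilin.mul_swap (isLinearMap_jump K x) (hflux K n x))
      fun a b v hv n => ?_
    exact (Mesh.isSimplex_cell K).integrableOn_facet hd hv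
      ((hfluxc b K n).continuousOn.mul (hj a K v hv))

theorem IsSimplex.diamCell_pos {S : Finset (Euc d)} (hd : 0 < d) (hS : IsSimplex S) :
    0 < diamCell S := by
  obtain ⟨a, ha, b, hb, hab⟩ := Finset.one_lt_card.1 (show 1 < S.card by rw [hS.1]; omega)
  exact Metric.diam_pos ⟨a, subset_convexHull ℝ _ ha, b, subset_convexHull ℝ _ hb, hab⟩
    (isCompact_hull S).isBounded

/-- The transport form is definite on the facet variables, for every positive penalty parameter. -/
theorem facet_form_definite (hd : 0 < d) {u : 𝒯.Cell → Euc d → Euc d}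
    (hu : ∀ K, Continuous (u K)) {D : Euc d → Euc d →L[ℝ] Euc d} (hD : Continuous D)
    {Dmin : ℝ} (hDmin : 0 < Dmin) (hDc : ∀ v x : Euc d, Dmin * ‖x‖ ^ 2 ≤ inner ℝ (D v x) x)
    {βc : ℝ} (hβc : 0 < βc) (w : Cbar 𝒯 ℓ)
    (h : advForm u (0 : Ch 𝒯 ℓ).1 w.1 (0 : Ch 𝒯 ℓ).1 w.1
      + diffForm D βc u (0 : Ch 𝒯 ℓ).1 w.1 (0 : Ch 𝒯 ℓ).1 w.1 = 0) : w = 0 := by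
  have hgrad : ∀ x : Euc d, gradient (0 : Euc d → ℝ) x = 0 := fun x => by
    simp [gradient]
  let P : 𝒯.Cell → Euc d → ℝ := fun K v => facetInt (facet K.2.1 v) fun x =>
    inner ℝ (-(w.1 x) • D (u K x) (outwardNormal K.2.1 v)) (-(w.1 x) • outwardNormal K.2.1 v)
  let N : 𝒯.Cell → Euc d → ℝ := fun K v => facetInt (facet K.2.1 v)
    ({x | inner ℝ (u K x) (outwardNormal K.2.1 v) < 0}.indicator fun x =>
        inner ℝ (u K x) (outwardNormal K.2.1 v) * (-(w.1 x)) * (-(w.1 x)))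
  -- With zero element parts every jump is `-w`, and each term containing an element value or a
  -- gradient drops out. Only the penalty `P` and the inflow part `N` survive.
  have hsum : ∑ K : 𝒯.Cell, ((βc / diamCell K.2.1) * ∑ v ∈ K.2.1, P K v
      + ∑ v ∈ K.2.1, -N K v) = 0 := by
    simp only [advForm, diffForm, bdryInt, Submodule.coe_zero, Pi.zero_apply, hgrad, map_zero,
      inner_zero_left, inner_zero_right, zero_mul, zero_sub, mul_zero] at h
    simp only [facetInt, integral_zero, Finset.sum_const_zero] at h
    simp only [Finset.sum_add_distrib, Finset.sum_neg_distrib, P, N, facetInt]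
    linarith
  have hpt : ∀ (K : 𝒯.Cell) (v : Euc d), v ∈ K.2.1 → ∀ x, Dmin * w.1 x ^ 2 ≤
      inner ℝ (-(w.1 x) • D (u K x) (outwardNormal K.2.1 v))
        (-(w.1 x) • outwardNormal K.2.1 v) := by
    intro K v hv x
    have h1 := hDc (u K x) (outwardNormal K.2.1 v)
    rw [(Mesh.isSimplex_cell K).norm_outwardNormal hd hv] at h1
    rw [real_inner_smul_left, real_inner_smul_right]
    nlinarith [sq_nonneg (w.1 x)]
  have hP0 : ∀ K v, v ∈ K.2.1 → 0 ≤ P K v := fun K v hv =>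
    integral_nonneg fun x => le_trans (by positivity) (hpt K v hv x)
  -- The integrand of `N` is `(u ⋅ n) w²` restricted to `u ⋅ n < 0`; the minus sign in front of the
  -- upwind term makes its contribution nonnegative.
  have hN0 : ∀ K v, 0 ≤ -N K v := by
    intro K v
    rw [neg_nonneg]
    refine integral_nonpos fun x => ?_
    refine indicator_nonpos (fun y hy => ?_) x
    have : inner ℝ (u K y) (outwardNormal K.2.1 v) < 0 := hy
    nlinarith [sq_nonneg (w.1 y)]
  have hβ : ∀ K : 𝒯.Cell, 0 < βc / diamCell K.2.1 := fun K =>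
    div_pos hβc ((Mesh.isSimplex_cell K).diamCell_pos hd)
  refine Cbar.eq_zero w fun K v hv => ?_
  have h1 := (Finset.sum_eq_zero_iff_of_nonneg fun K _ => add_nonneg
    (mul_nonneg (hβ K).le (Finset.sum_nonneg fun v hv => hP0 K v hv))
    (Finset.sum_nonneg fun v _ => hN0 K v)).1 hsum K (Finset.mem_univ K)
  have h2 : ∑ v ∈ K.2.1, P K v = 0 := by
    have := ((add_eq_zero_iff_of_nonneg
      (mul_nonneg (hβ K).le (Finset.sum_nonneg fun v hv => hP0 K v hv))
      (Finset.sum_nonneg fun v _ => hN0 K v)).1 h1).1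
    exact (mul_eq_zero.1 this).resolve_left (hβ K).ne'
  have h3 := (Finset.sum_eq_zero_iff_of_nonneg fun v hv => hP0 K v hv).1 h2 v hv
  have hwc := (Cbar.continuousOn_facet w K hv).neg
  have h4 := (Mesh.isSimplex_cell K).eqOn_zero_of_facetInt_eq_zero hd hv
    ((hwc.smul ((hD.comp (hu K)).clm_apply continuous_const).continuousOn).inner
      (hwc.smul continuousOn_const)) (fun x _ => le_trans (by positivity) (hpt K v hv x)) h3
  intro x hx
  have h5 := hpt K v hv x
  replace h5 := h5.trans (h4 x hx).le
  have h6 : w.1 x ^ 2 ≤ 0 := by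
    by_contra! h7
    nlinarith [mul_pos hDmin h7]
  exact pow_eq_zero_iff (two_ne_zero) |>.1 (le_antisymm h6 (sq_nonneg _))

end

section

variable {d ℓ : ℕ} {Ω : SplitDomain d} {𝒯 : Mesh Ω}

/-! ### The mass form and the load functional -/

theorem isBilin_mass (ρ : 𝒯.Cell → ℝ) : IsBilin fun a b : Ch 𝒯 ℓ =>
    ∑ K : 𝒯.Cell, ∫ x in hull K.2.1, ρ K * a.1 K x * b.1 K x := by
  refine IsBilin.sum _ fun K _ => IsBilin.integral (fun x => ?_) fun a b => ?_
  · simp only [mul_assoc]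
    exact IsBilin.const_mul _ (IsBilin.mul ⟨fun _ _ => rfl, fun _ _ => rfl⟩
      ⟨fun _ _ => rfl, fun _ _ => rfl⟩)
  · exact ((continuous_const.mul (continuous_of_mem_polyFun (Ch.mem_polyFun a K))).mul
      (continuous_of_mem_polyFun (Ch.mem_polyFun b K))).continuousOn.integrableOn_compact
        (isCompact_hull _)

theorem mass_definite {ρ : 𝒯.Cell → ℝ} (hρ : ∀ K, 0 < ρ K) (a : Ch 𝒯 ℓ)
    (h : ∑ K : 𝒯.Cell, ∫ x in hull K.2.1, ρ K * a.1 K x * a.1 K x = 0) : a = 0 := by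
  have h0 : ∀ (K : 𝒯.Cell) x, 0 ≤ ρ K * a.1 K x * a.1 K x := fun K x => by
    rw [mul_assoc]; exact mul_nonneg (hρ K).le (mul_self_nonneg _)
  have h1 := (Finset.sum_eq_zero_iff_of_nonneg fun K _ => integral_nonneg (h0 K)).1 h
  ext K : 2
  have hc := continuous_of_mem_polyFun (Ch.mem_polyFun a K)
  have hi := (Mesh.isSimplex_cell K).interior_hull_nonempty
  refine eq_zero_of_mem_polyFun (Ch.mem_polyFun a K) hi fun x hx => ?_
  have h2 := eqOn_zero_of_setIntegral_eq_zero (isCompact_hull _) (convex_convexHull ℝ _) hi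
    ((continuous_const.mul hc).mul hc).continuousOn (fun x _ => h0 K x) (h1 K (Finset.mem_univ K))
    x hx
  simpa [(hρ K).ne'] using h2

/-- Cells are closed and may meet the boundary, whereas the data live on the open set `Ω`. A point
interior to one of the simplices covering the closure is interior to the closure, hence in `Ω`; so
the difference lies in finitely many frontiers of convex sets, which are null. -/
theorem volume_closure_diff_whole (Ω : SplitDomain d) :
    volume (closure Ω.whole \ Ω.whole) = 0 := by
  obtain ⟨-, -, hint, 𝒮, -, h𝒮⟩ := Ω.polygonal_whole
  have hsub : closure Ω.whole \ Ω.whole ⊆ ⋃ S ∈ 𝒮, frontier (hull S) := by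
    rintro x ⟨hx, hx'⟩
    have hx0 := hx
    rw [h𝒮] at hx
    obtain ⟨S, hS, hxS⟩ := mem_iUnion₂.1 hx
    refine mem_iUnion₂.2 ⟨S, hS, subset_closure hxS, fun hxi => hx' ?_⟩
    rw [← hint]
    refine interior_mono ?_ hxi
    rw [h𝒮]
    exact subset_biUnion_of_mem (u := fun S => hull S) hS
  refine measure_mono_null hsub ((measure_biUnion_null_iff 𝒮.countable_toSet).2 fun S _ => ?_)
  exact (convex_convexHull ℝ _).addHaar_frontier volume

theorem Mesh.hull_subset_closure (K : 𝒯.Cell) : hull K.2.1 ⊆ closure Ω.whole := by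
  intro x hx
  have h1 : x ∈ closure (Ω.part K.1) := by
    rw [← 𝒯.cover]; exact mem_iUnion₂.2 ⟨_, K.2.2, hx⟩
  rw [Ω.closure_whole]
  rcases hK : K.1 with _ | _ <;> rw [hK] at h1
  exacts [Or.inl h1, Or.inr h1]

theorem restrict_hull_eq (K : 𝒯.Cell) : volume.restrict (hull K.2.1)
    = (volume.restrict Ω.whole).restrict (hull K.2.1) := by
  rw [Measure.restrict_restrict (measurableSet_hull _)]
  refine Measure.restrict_congr_set ?_
  filter_upwards [measure_eq_zero_iff_ae_notMem.1 (volume_closure_diff_whole Ω)] with x hx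
  refine propext ⟨fun h => ⟨h, ?_⟩, fun h => h.1⟩
  by_contra hxΩ
  exact hx ⟨Mesh.hull_subset_closure K h, hxΩ⟩

theorem memLp_restrict_hull (K : 𝒯.Cell) (f : Lp ℝ 2 (volume.restrict Ω.whole)) :
    MemLp f 2 (volume.restrict (hull K.2.1)) := by
  rw [restrict_hull_eq]
  exact (Lp.memLp f).restrict _

theorem memLp_hull_of_continuous (S : Finset (Euc d)) {q : Euc d → ℝ} (hq : Continuous q) :
    MemLp q 2 (volume.restrict (hull S)) := by
  have : IsFiniteMeasure (volume.restrict (hull S)) :=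
    ⟨by simpa using (isCompact_hull S).measure_lt_top⟩
  obtain ⟨C, hC⟩ := (isCompact_hull S).exists_bound_of_continuousOn hq.continuousOn
  exact MemLp.of_bound hq.aestronglyMeasurable C ((ae_restrict_iff' (measurableSet_hull S)).2
    (Filter.Eventually.of_forall hC))

theorem exists_load_functional (f : Lp ℝ 2 (volume.restrict Ω.whole)) :
    ∃ L : Ch 𝒯 ℓ →ₗ[ℝ] ℝ, ∀ w, L w = ∑ K : 𝒯.Cell, ∫ x in hull K.2.1, f x * w.1 K x := by
  have hi : ∀ (K : 𝒯.Cell) (w : Ch 𝒯 ℓ), IntegrableOn (fun x => f x * w.1 K x) (hull K.2.1) :=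
    fun K w => (memLp_restrict_hull K f).integrable_mul
      (memLp_hull_of_continuous _ (continuous_of_mem_polyFun (Ch.mem_polyFun w K)))
  refine ⟨⟨⟨fun w => ∑ K : 𝒯.Cell, ∫ x in hull K.2.1, f x * w.1 K x, fun a b => ?_⟩,
    fun r a => ?_⟩, fun _ => rfl⟩
  · rw [← Finset.sum_add_distrib]
    refine Finset.sum_congr rfl fun K _ => ?_
    rw [← integral_add (hi K a) (hi K b)]
    exact integral_congr_ae (Filter.Eventually.of_forall fun x => mul_add _ _ _)
  · simp only [RingHom.id_apply, smul_eq_mul, Finset.mul_sum]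
    refine Finset.sum_congr rfl fun K _ => ?_
    rw [← integral_const_mul]
    exact integral_congr_ae (Filter.Eventually.of_forall fun x => mul_left_comm _ _ _)

/-- The load pairing as a function of `f` with `w` fixed: on each cell it is the `L²` inner product
with `w` truncated to that cell. Its continuity transfers integrability and continuity in time from
`f` to the right-hand side of the system. -/
theorem exists_continuous_load (w : Ch 𝒯 ℓ) :
    ∃ L : Lp ℝ 2 (volume.restrict Ω.whole) →L[ℝ] ℝ,
      ∀ f, L f = ∑ K : 𝒯.Cell, ∫ x in hull K.2.1, f x * w.1 K x := by
  have hcell : ∀ K : 𝒯.Cell, ∃ L : Lp ℝ 2 (volume.restrict Ω.whole) →L[ℝ] ℝ,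
      ∀ f, L f = ∫ x in hull K.2.1, f x * w.1 K x := by
    intro K
    have hm : MemLp ((hull K.2.1).indicator (w.1 K)) 2 (volume.restrict Ω.whole) := by
      rw [memLp_indicator_iff_restrict (measurableSet_hull _), ← restrict_hull_eq]
      exact memLp_hull_of_continuous _ (continuous_of_mem_polyFun (Ch.mem_polyFun w K))
    refine ⟨innerSL ℝ hm.toLp, fun f => ?_⟩
    rw [innerSL_apply_apply, L2.inner_def, restrict_hull_eq,
      ← integral_indicator (measurableSet_hull _)]
    refine integral_congr_ae ?_
    filter_upwards [hm.coeFn_toLp] with x hx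
    rw [hx]
    by_cases h : x ∈ hull K.2.1 <;> simp [h]
  choose L hL using hcell
  exact ⟨∑ K, L K, fun f => by simp [hL]⟩

end

section

variable {d ℓ : ℕ} {Ω : SplitDomain d} {𝒯 : Mesh Ω}

/-! ### Reduction of the semi-discrete scheme to a linear system -/

/-- Evaluation of an element of `C_h` in a cell. -/
def Ch.eval (z : 𝒯.Cell × Euc d) : Ch 𝒯 ℓ →ₗ[ℝ] ℝ :=
  LinearMap.proj z.2 ∘ₗ LinearMap.proj z.1 ∘ₗ (Ch 𝒯 ℓ).subtype

/-- Point evaluations span the dual, so regularity in time required at each point of each cell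
passes to all linear functionals, in particular to coordinates. -/
theorem Ch.dual_induction {P : (Ch 𝒯 ℓ →ₗ[ℝ] ℝ) → Prop} (heval : ∀ z, P (Ch.eval z)) (zero : P 0)
    (add : ∀ ψ χ, P ψ → P χ → P (ψ + χ)) (smul : ∀ (r : ℝ) ψ, P ψ → P (r • ψ))
    (ψ : Ch 𝒯 ℓ →ₗ[ℝ] ℝ) : P ψ := by
  have hψ : ψ ∈ Submodule.span ℝ (range (Ch.eval (𝒯 := 𝒯) (ℓ := ℓ))) := by
    rw [span_range_eval_eq_top _ fun v hv => ?_]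
    · exact Submodule.mem_top
    · ext K x
      exact hv (K, x)
  induction hψ using Submodule.span_induction with
  | mem ψ h => obtain ⟨z, rfl⟩ := h; exact heval z
  | zero => exact zero
  | add ψ χ _ _ h₁ h₂ => exact add ψ χ h₁ h₂
  | smul r ψ _ h => exact smul r ψ h

theorem Ch.hasDerivWithinAt_iff {n : ℕ} (e : Ch 𝒯 ℓ ≃ₗ[ℝ] (Fin n → ℝ)) {c : ℝ → Ch 𝒯 ℓ}
    {c' : Ch 𝒯 ℓ} {s : Set ℝ} {t : ℝ} :
    (∀ K x, HasDerivWithinAt (fun r => (c r).1 K x) (c'.1 K x) s t) ↔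
      HasDerivWithinAt (fun r => e (c r)) (e c') s t := by
  constructor
  · intro h
    refine hasDerivWithinAt_pi.2 fun i => ?_
    refine Ch.dual_induction (P := fun ψ => HasDerivWithinAt (fun r => ψ (c r)) (ψ c') s t)
      (fun z => h z.1 z.2) (hasDerivWithinAt_const t s 0) (fun _ _ h₁ h₂ => h₁.add h₂)
      (fun r _ h => h.const_mul r) (LinearMap.proj i ∘ₗ e.toLinearMap)
  · intro h K x
    let L : (Fin n → ℝ) →L[ℝ] ℝ := LinearMap.toContinuousLinearMap
      (Ch.eval (𝒯 := 𝒯) (ℓ := ℓ) (K, x) ∘ₗ e.symm.toLinearMap)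
    have hL : ∀ a : Ch 𝒯 ℓ, L (e a) = a.1 K x := fun a => by
      change ((e.symm (e a)).1 K x) = _
      rw [e.symm_apply_apply]
    have := L.hasFDerivAt.comp_hasDerivWithinAt t h
    rw [hL] at this
    exact this.congr (fun r _ => (hL _).symm) (hL _).symm

theorem Ch.absolutelyContinuousOnInterval_iff {n : ℕ} (e : Ch 𝒯 ℓ ≃ₗ[ℝ] (Fin n → ℝ))
    {c : ℝ → Ch 𝒯 ℓ} {a b : ℝ} :
    (∀ K x, AbsolutelyContinuousOnInterval (fun r => (c r).1 K x) a b) ↔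
      ∀ i, AbsolutelyContinuousOnInterval (fun r => e (c r) i) a b := by
  constructor
  · intro h i
    have key : ∀ ψ : Ch 𝒯 ℓ →ₗ[ℝ] ℝ, AbsolutelyContinuousOnInterval (fun r => ψ (c r)) a b := by
      refine Ch.dual_induction (fun z => h z.1 z.2) ?_ (fun ψ χ h₁ h₂ => ?_) fun r ψ h => ?_
      · simpa using (contDiff_const (c := (0 : ℝ)) (n := 1)).contDiffOn
          |>.absolutelyContinuousOnInterval
      · simp only [LinearMap.add_apply]
        exact AbsolutelyContinuousOnInterval.add (f := fun r => ψ (c r)) (g := fun r => χ (c r)) h₁ h₂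
      · simp only [LinearMap.smul_apply, smul_eq_mul]
        exact AbsolutelyContinuousOnInterval.const_mul (f := fun s => ψ (c s)) r h
    have := key (LinearMap.proj i ∘ₗ e.toLinearMap)
    simpa only [LinearMap.comp_apply, LinearMap.proj_apply, LinearEquiv.coe_coe] using this
  · intro h K x
    have hL : ∀ r, (c r).1 K x
        = ∑ i, Ch.eval (𝒯 := 𝒯) (ℓ := ℓ) (K, x) (e.symm (Pi.single i 1)) * e (c r) i := by
      intro r
      have h1 : (c r).1 K x = (Ch.eval (𝒯 := 𝒯) (ℓ := ℓ) (K, x) ∘ₗ e.symm.toLinearMap) (e (c r)) := by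
        change _ = ((e.symm (e (c r))).1 K x)
        rw [e.symm_apply_apply]
      rw [h1]
      conv_lhs => rw [pi_eq_sum_univ' (e (c r))]
      simp [mul_comm]
    simp only [hL]
    exact absolutelyContinuousOnInterval_sum _ fun i _ => (h i).const_mul _

theorem Ch.continuousOn_iff {n : ℕ} (e : Ch 𝒯 ℓ ≃ₗ[ℝ] (Fin n → ℝ)) {c : ℝ → Ch 𝒯 ℓ} {s : Set ℝ} :
    (∀ K x, ContinuousOn (fun r => (c r).1 K x) s) ↔ ContinuousOn (fun r => e (c r)) s := by
  constructor
  · intro h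
    refine continuousOn_pi.2 fun i => ?_
    exact Ch.dual_induction (P := fun ψ => ContinuousOn (fun r => ψ (c r)) s)
      (fun z => h z.1 z.2) continuousOn_const (fun _ _ h₁ h₂ => h₁.add h₂)
      (fun r _ h => h.const_smul r) (LinearMap.proj i ∘ₗ e.toLinearMap)
  · intro h K x
    have hL := (LinearMap.toContinuousLinearMap
      (Ch.eval (𝒯 := 𝒯) (ℓ := ℓ) (K, x) ∘ₗ e.symm.toLinearMap)).continuous.comp_continuousOn h
    refine hL.congr fun r _ => ?_
    change _ = ((e.symm (e (c r))).1 K x)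
    rw [e.symm_apply_apply]

theorem exists_l2Projection (c₀ : Lp ℝ 2 (volume.restrict Ω.whole)) :
    ∃ p : Ch 𝒯 ℓ, ∀ c, IsL2Projection ℓ c₀ c ↔ c = p := by
  obtain ⟨m, hm⟩ := isBilin_mass (𝒯 := 𝒯) (ℓ := ℓ) fun _ => 1
  obtain ⟨G, hG⟩ := exists_unique_of_definite m fun v hv =>
    mass_definite (fun _ => one_pos) v ((hm v v).symm.trans hv)
  obtain ⟨L, hL⟩ := exists_load_functional (𝒯 := 𝒯) (ℓ := ℓ) c₀
  refine ⟨G L, fun c => ?_⟩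
  rw [← hG]
  refine forall_congr' fun w => ?_
  rw [hm, hL]
  simp only [one_mul]

/-- In coordinates `e` of `C_h`, the scheme is a linear system of differential equations for `c_h`
together with an explicit formula for `c̄_h`. -/
theorem exists_solvesAt_iff (hd : 0 < d) {φ : ℝ} (hφ : 0 < φ) {u : 𝒯.Cell → Euc d → Euc d}
    (hu : ∀ K, Continuous (u K)) {D : Euc d → Euc d →L[ℝ] Euc d} (hD : Continuous D)
    {Dmin : ℝ} (hDmin : 0 < Dmin) (hDc : ∀ v x : Euc d, Dmin * ‖x‖ ^ 2 ≤ inner ℝ (D v x) x)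
    {βc : ℝ} (hβc : 0 < βc) :
    ∃ (n : ℕ) (e : Ch 𝒯 ℓ ≃ₗ[ℝ] (Fin n → ℝ)) (R : Ch 𝒯 ℓ → Cbar 𝒯 ℓ)
      (A : (Fin n → ℝ) →L[ℝ] (Fin n → ℝ)) (Γ : Lp ℝ 2 (volume.restrict Ω.whole) →L[ℝ] (Fin n → ℝ)),
      ∀ T f c t, SolvesAt ℓ φ D βc u T f c t ↔ (c t).2 = R (c t).1 ∧
        HasDerivWithinAt (fun s => e (c s).1) (A (e (c t).1) + Γ (f t)) (Icc 0 T) t := by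
  have hρ : ∀ K : 𝒯.Cell, 0 < porosity φ K.1 := by
    rintro ⟨_ | _, S⟩
    exacts [one_pos, hφ]
  obtain ⟨m, hm⟩ := isBilin_mass (𝒯 := 𝒯) (ℓ := ℓ) fun K => porosity φ K.1
  obtain ⟨B, hB⟩ := (isBilin_advForm (𝒯 := 𝒯) (ℓ := ℓ) hd hu).add
    (isBilin_diffForm hd hu hD βc)
  obtain ⟨R, A, G, hG⟩ := exists_reduction m
    (fun v hv => mass_definite hρ v ((hm v v).symm.trans hv)) B
    (fun w hw => facet_form_definite hd hu hD hDmin hDc hβc w ((hB _ _).symm.trans hw))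
  choose Λ hΛ using exists_load_functional (𝒯 := 𝒯) (ℓ := ℓ)
  choose Λ' hΛ' using exists_continuous_load (𝒯 := 𝒯) (ℓ := ℓ)
  let e := (Module.finBasis ℝ (Ch 𝒯 ℓ)).equivFun
  -- The `i`-th coordinate of `G ψ` is linear in `ψ`, so by reflexivity it is evaluation of `ψ` at a
  -- vector `v i`. Each coordinate of the forcing is thus the load tested with `v i`, which is
  -- continuous in `f`.
  let v := fun i => (Module.evalEquiv ℝ (Ch 𝒯 ℓ)).symm (LinearMap.proj i ∘ₗ e.toLinearMap ∘ₗ G)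
  have hv : ∀ ψ i, e (G ψ) i = ψ (v i) := fun ψ i =>
    (Module.apply_evalEquiv_symm_apply ℝ (Ch 𝒯 ℓ) ψ
      (LinearMap.proj i ∘ₗ e.toLinearMap ∘ₗ G)).symm
  refine ⟨_, e, R, LinearMap.toContinuousLinearMap (e.toLinearMap ∘ₗ A ∘ₗ e.symm.toLinearMap),
    ContinuousLinearMap.pi fun i => Λ' (v i), fun T f c t => ?_⟩
  have hΓ : ContinuousLinearMap.pi (fun i => Λ' (v i)) (f t) = e (G (Λ (f t))) := by
    ext i
    rw [hv, hΛ]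
    exact hΛ' _ _
  have hA : LinearMap.toContinuousLinearMap (e.toLinearMap ∘ₗ A ∘ₗ e.symm.toLinearMap) (e (c t).1)
      = e (A (c t).1) := by
    change e (A (e.symm (e (c t).1))) = _
    rw [e.symm_apply_apply]
  rw [hΓ, hA, ← map_add, ← Ch.hasDerivWithinAt_iff e]
  have heq : ∀ dc : Ch 𝒯 ℓ, (∀ w : Ch 𝒯 ℓ × Cbar 𝒯 ℓ,
      (∑ K : 𝒯.Cell, ∫ x in hull K.2.1, porosity φ K.1 * dc.1 K x * w.1.1 K x)
        + (advForm u (c t).1.1 (c t).2.1 w.1.1 w.2.1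
            + diffForm D βc u (c t).1.1 (c t).2.1 w.1.1 w.2.1)
        = ∑ K : 𝒯.Cell, ∫ x in hull K.2.1, f t x * w.1.1 K x) ↔
      (c t).2 = R (c t).1 ∧ dc = A (c t).1 + G (Λ (f t)) := by
    intro dc
    rw [← hG]
    refine forall_congr' fun w => ?_
    rw [hm, hB, hΛ]
  unfold SolvesAt
  simp only [heq]
  constructor
  · rintro ⟨dc, h1, h2, rfl⟩
    exact ⟨h2, h1⟩
  · rintro ⟨h2, h1⟩
    exact ⟨_, h1, h2, rfl⟩

end

end StokesDarcyTransport

end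

/-! ### Existence and uniqueness for the semi-discrete scheme -/

open StokesDarcyTransport in
theorem mainTheorem4
    {d : ℕ} (hd : d = 2 ∨ d = 3) (Ω : SplitDomain d) (𝒯 : Mesh Ω)
    -- the flow problem and its EDG-HDG solution
    (k : ℕ) (hk : 1 ≤ k) (μ κ α βf : ℝ) (hμ : 0 < μ) (hκ : 0 < κ) (hα : 0 < α) (hβf : 0 < βf)
    (fs : Lp (Euc d) 2 (volume.restrict (Ω.part .stokes)))
    (fd : Lp ℝ 2 (volume.restrict (Ω.part .darcy)))
    (U : FlowField 𝒯) (hU : IsFlowSolution k μ κ α βf fs fd U)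
    -- the transport problem
    (ℓ : ℕ) (φ : ℝ) (hφ : 0 < φ) (hφ' : φ ≤ 1)
    (D : Euc d → Euc d →L[ℝ] Euc d) (Dmin C : ℝ) (hDmin : 0 < Dmin) (hC : 0 < C)
    (hD_coercive : ∀ v x : Euc d, Dmin * ‖x‖ ^ 2 ≤ inner ℝ (D v x) x)
    (hD_bound : ∀ v : Euc d, ‖D v‖ ≤ C * (1 + ‖v‖))
    (hD_lipschitz : ∀ v v' : Euc d, ‖D v - D v'‖ ≤ C * ‖v - v'‖)
    (βc : ℝ) (hβc : 0 < βc) (T : ℝ) (hT : 0 < T)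
    (f : ℝ → Lp ℝ 2 (volume.restrict Ω.whole)) (hf : MemLp f 2 (volume.restrict (Ioc 0 T)))
    (c₀ : Lp ℝ 2 (volume.restrict Ω.whole)) :
    (∃ c : ℝ → Ch 𝒯 ℓ × Cbar 𝒯 ℓ, IsSolution ℓ φ D βc U.u T f c₀ c ∧
      ∀ c' : ℝ → Ch 𝒯 ℓ × Cbar 𝒯 ℓ, IsSolution ℓ φ D βc U.u T f c₀ c' →
        (∀ t ∈ Icc 0 T, (c' t).1 = (c t).1) ∧
        ∀ᵐ t ∂(volume.restrict (Ioc 0 T)), (c' t).2 = (c t).2) ∧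
    (ContinuousOn f (Ioc 0 T) →
      ∃ c : ℝ → Ch 𝒯 ℓ × Cbar 𝒯 ℓ, IsClassicalSolution ℓ φ D βc U.u T f c₀ c ∧
        ∀ c' : ℝ → Ch 𝒯 ℓ × Cbar 𝒯 ℓ, IsClassicalSolution ℓ φ D βc U.u T f c₀ c' →
          (∀ t ∈ Icc 0 T, (c' t).1 = (c t).1) ∧
          ∀ t ∈ Ioc 0 T, (c' t).2 = (c t).2) := by
  have hd0 : 0 < d := by omega
  have hu : ∀ K, Continuous (U.u K) := fun K => by
    have h1 : Continuous fun x => EuclideanSpace.equiv (Fin d) ℝ (U.u K x) :=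
      continuous_pi fun i => continuous_of_mem_polyFun (hU.1.u_poly K i)
    exact (EuclideanSpace.equiv (Fin d) ℝ).symm.continuous.comp h1
  have hD : Continuous D := by
    refine (LipschitzWith.of_dist_le_mul (K := ⟨C, hC.le⟩) fun v v' => ?_).continuous
    rw [dist_eq_norm, dist_eq_norm]
    exact hD_lipschitz v v'
  obtain ⟨n, e, R, A, Γ, hsolves⟩ := exists_solvesAt_iff (𝒯 := 𝒯) (ℓ := ℓ) hd0 hφ hu hD hDmin
    hD_coercive hβc
  obtain ⟨p, hp⟩ := exists_l2Projection (𝒯 := 𝒯) (ℓ := ℓ) c₀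
  have hint : IntegrableOn (fun t => Γ (f t)) (Ioc 0 T) := (Γ.comp_memLp' hf).integrable one_le_two
  obtain ⟨y, hy0, hyac, hyae, hycl⟩ := exists_linear_ode_solution A (e p) hT hint
  -- The same function serves both parts: continuity of `f` only improves the set of times at which
  -- the equation is known to hold.
  let c : ℝ → Ch 𝒯 ℓ × Cbar 𝒯 ℓ := fun t => (e.symm (y t), R (e.symm (y t)))
  have hec : ∀ t, e (c t).1 = y t := fun t => e.apply_symm_apply _
  have hac : ∀ K x, AbsolutelyContinuousOnInterval (fun s => (c s).1.1 K x) 0 T := by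
    refine (Ch.absolutelyContinuousOnInterval_iff e (c := fun s => (c s).1)).2 ?_
    simpa only [hec] using hyac
  have hinit : IsL2Projection ℓ c₀ (c 0).1 := by
    rw [hp]
    change e.symm (y 0) = p
    rw [hy0, e.symm_apply_apply]
  -- The load cancels in the difference of two solutions, leaving the homogeneous system with zero
  -- initial value.
  have hsub : ∀ {c' : ℝ → Ch 𝒯 ℓ × Cbar 𝒯 ℓ} {t : ℝ}, SolvesAt ℓ φ D βc U.u T f c t →
      SolvesAt ℓ φ D βc U.u T f c' t → HasDerivWithinAt (fun s => e (c' s).1 - e (c s).1)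
        (A (e (c' t).1 - e (c t).1)) (Icc 0 T) t := by
    intro c' t h h'
    convert! ((hsolves T f c' t).1 h').2.sub ((hsolves T f c t).1 h).2 using 1
    rw [map_sub]
    abel
  have hsub0 : ∀ {c' : ℝ → Ch 𝒯 ℓ × Cbar 𝒯 ℓ}, IsL2Projection ℓ c₀ (c' 0).1 →
      e (c' 0).1 - e (c 0).1 = 0 := by
    intro c' h
    rw [(hp _).1 h, (hp _).1 hinit, sub_self]
  have hbar : ∀ {c' : ℝ → Ch 𝒯 ℓ × Cbar 𝒯 ℓ} {t : ℝ}, SolvesAt ℓ φ D βc U.u T f c t →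
      SolvesAt ℓ φ D βc U.u T f c' t → (c' t).1 = (c t).1 → (c' t).2 = (c t).2 := by
    intro c' t h h' heq
    rw [((hsolves T f c' t).1 h').1, ((hsolves T f c t).1 h).1, heq]
  constructor
  · have hsol : IsSolution ℓ φ D βc U.u T f c₀ c := by
      refine ⟨hinit, hac, ?_⟩
      filter_upwards [hyae] with t ht
      refine (hsolves T f c t).2 ⟨rfl, ?_⟩
      simpa only [hec] using ht
    refine ⟨c, hsol, fun c' hc' => ?_⟩
    have heq : ∀ t ∈ Icc 0 T, (c' t).1 = (c t).1 := by
      intro t ht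
      refine e.injective (sub_eq_zero.1 (eq_zero_of_ae_hasDerivWithinAt A hT
        (y := fun s => e (c' s).1 - e (c s).1) (hsub0 hc'.initial) (fun i => ?_) ?_ t ht))
      · exact ((Ch.absolutelyContinuousOnInterval_iff e (c := fun s => (c' s).1)).1 hc'.absCont
          i).sub ((Ch.absolutelyContinuousOnInterval_iff e (c := fun s => (c s).1)).1 hac i)
      · filter_upwards [hsol.equation, hc'.equation] with s h h' using hsub h h'
    refine ⟨heq, ?_⟩
    filter_upwards [hsol.equation, hc'.equation, ae_restrict_mem measurableSet_Ioc]
      with t h h' ht using hbar h h' (heq t ⟨ht.1.le, ht.2⟩)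
  · intro hfc
    have hsol : IsClassicalSolution ℓ φ D βc U.u T f c₀ c := by
      refine ⟨hinit, fun K x => ?_, fun t ht => (hsolves T f c t).2 ⟨rfl, ?_⟩⟩
      · rw [← uIcc_of_le hT.le]
        exact (hac K x).continuousOn
      · simpa only [hec] using hycl (Γ.continuous.comp_continuousOn hfc) t ht
    refine ⟨c, hsol, fun c' hc' => ?_⟩
    have heq : ∀ t ∈ Icc 0 T, (c' t).1 = (c t).1 := by
      intro t ht
      refine e.injective (sub_eq_zero.1 (eq_zero_of_forall_hasDerivWithinAt A
        (y := fun s => e (c' s).1 - e (c s).1) (hsub0 hc'.initial) ?_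
        (fun s hs => hsub (hsol.equation s hs) (hc'.equation s hs)) t ht))
      exact ((Ch.continuousOn_iff e (c := fun s => (c' s).1)).1 hc'.continuous).sub
        ((Ch.continuousOn_iff e (c := fun s => (c s).1)).1 hsol.continuous)
    exact ⟨heq, fun t ht => hbar (hsol.equation t ht) (hc'.equation t ht)
      (heq t ⟨ht.1.le, ht.2⟩)⟩
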